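/- Let $n\ge 1$ be an integer and let $\mu\ge 0$, $p>1$, $R\ge 1$ be real. Write $[x]_\pm=\frac{|x|\pm x}{2}$ and put $$\gamma_F(p,\nu)=2-\nu(p-1),\qquad \gamma_S(p,\nu)=2+(\nu+1)p-(\nu-1)p^2,\qquad \mu_*=\frac{n^2+n+2}{n+2},$$ $$p_F(\nu)=\begin{cases}1+\frac2\nu,&\nu>0,\\+\infty,&\nu\le0,\end{cases}\qquad p_S(\nu)=\begin{cases}\frac{\nu+1+\sqrt{\nu^2+10\nu-7}}{2(\nu-1)},&\nu>1,\\+\infty,&\nu\le1,\end{cases}$$ $$p_\mu(n)=\max\{p_F(n-[\mu-1]_-),\,p_S(n+\mu)\}.$$ For $\varepsilon>0$ consider the Cauchy problem $$u_{tt}-\Delta u+\frac{\mu}{1+t}u_t=|u|^p\ \text{ in }\mathbb R^n\times(0,T),\qquad u(x,0)=\varepsilon f(x),\quad u_t(x,0)=\varepsilon g(x).\tag{1}$$ An energy solution of (1) on $[0,T)$ is a real-valued $u\in C([0,T),H^1(\mathbb R^n))\cap C^1([0,T),L^2(\mathbb R^n))\cap C((0,T),L^p_{loc}(\mathbb R^n))$,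 with $|u|^p$ integrable on $K\times(0,t)$ for every compact $K\subset\mathbb R^n$ and every $t<T$, such that $u(\cdot,0)=\varepsilon f$, $u_t(\cdot,0)=\varepsilon g$ and $$\int_{\mathbb R^n} u_t(x,t)\phi(x,t)\,dx-\int_{\mathbb R^n}\varepsilon g(x)\phi(x,0)\,dx+\int_0^t\!\!\int_{\mathbb R^n}\{-u_t\phi_t+\nabla u\cdot\nabla\phi\}\,dx\,ds+\int_0^t\!\!\int_{\mathbb R^n}\frac{\mu}{1+s}u_t\phi\,dx\,ds=\int_0^t\!\!\int_{\mathbb R^n}|u|^p\phi\,dx\,ds$$ for all $t\in[0,T)$ and all $\phi\in C_0^\infty(\mathbb R^n\times[0,T))$. Let the blow-up time $T_\varepsilon\in[0,\infty]$ be the supremum of all $T>0$ for which (1) has an energy solution on $[0,T)$ with $\operatorname{supp}u\subset\{(x,t):|x|\le t+R\}$ (with $T_\varepsilon=0$ if there is none). **Theorem.** Let $1<p<p_\mu(n)$, $f\in H^1(\mathbb R^n)$ and $g\in L^2(\mathbb R^n)$. Assume that $f\ge0$ almost everywhere, and that $[\mu-1]_+f+g$ is nonnegative almost everywhere and is not almost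 everywhere zero. Then there are constants $\varepsilon_1>0$ and $C>0$, depending only on $f,g,\mu,n,p,R$, such that for all $0<\varepsilon\le\varepsilon_1$: * if $\mu<\mu_*$, then (with $\frac{2}{n-|\mu-1|}:=+\infty$ for $n=1$, $\mu=0$; otherwise $n-|\mu-1|>0$) $$T_\varepsilon\le\begin{cases}C\,\varepsilon^{-(p-1)/\gamma_F(p,\,n-[\mu-1]_-)},& p\le\frac{2}{n-|\mu-1|},\\ C\,\varepsilon^{-2p(p-1)/\gamma_S(p,\,n+\mu)},& p>\frac{2}{n-|\mu-1|};\end{cases}$$ * if $\mu\ge\mu_*$, then $$T_\varepsilon\le C\,\varepsilon^{-(p-1)/\gamma_F(p,n)}=C\,\varepsilon^{-[2/(p-1)-n]^{-1}};$$ * if $\mu=n=1$ and $p\le2$, then moreover $T_\varepsilon\le C\,\phi_0(\varepsilon)$, where $\phi_0=\phi_0(\varepsilon)$ is the unique positive solution of $$\varepsilon\,\phi_0^{\frac{2}{p-1}-1}\ln(1+\phi_0)=1.$$ -/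

import Mathlib

open MeasureTheory Set Filter
open scoped Topology ENNReal ContDiff

noncomputable section

namespace DampedWave

/-- The spatial domain `ℝⁿ` with its Euclidean norm. -/
abbrev Space (n : ℕ) : Type := EuclideanSpace ℝ (Fin n)

/-- The Fujita exponent `p_F(ν)`, with value `+∞` for `ν ≤ 0`. -/
def pFujita (ν : ℝ) : EReal :=
  if 0 < ν then ((1 + 2 / ν : ℝ) : EReal) else ⊤

/-- The Strauss exponent `p_S(ν)`, with value `+∞` for `ν ≤ 1`. -/
def pStrauss (ν : ℝ) : EReal :=
  if 1 < ν then (((ν + 1 + Real.sqrt (ν ^ 2 + 10 * ν - 7)) / (2 * (ν - 1)) : ℝ) : EReal) else ⊤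

/-- `γ_F(p, ν) = 2 - ν (p - 1)`. -/
def gammaF (p ν : ℝ) : ℝ := 2 - ν * (p - 1)

/-- `γ_S(p, ν) = 2 + (ν + 1) p - (ν - 1) p²`. -/
def gammaS (p ν : ℝ) : ℝ := 2 + (ν + 1) * p - (ν - 1) * p ^ 2

/-- The threshold `μ_*(n) = (n² + n + 2) / (n + 2)`. -/
def muStar (n : ℕ) : ℝ := ((n : ℝ) ^ 2 + n + 2) / (n + 2)

/-- The exponent `p_μ(n) = max {p_F(n - [μ - 1]₋), p_S(n + μ)}`. -/
def pCrit (n : ℕ) (μ : ℝ) : EReal :=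
  max (pFujita (n - (μ - 1)⁻)) (pStrauss (n + μ))

/-- `G` is the weak gradient of `w` on `ℝⁿ`: `∫ w ∇ψ = - ∫ ψ G` for all `ψ ∈ C_c^∞(ℝⁿ)`. -/
def IsWeakGradient {n : ℕ} (w : Space n → ℝ) (G : Space n → Space n) : Prop :=
  ∀ ψ : Space n → ℝ, ContDiff ℝ ∞ ψ → HasCompactSupport ψ →
    ∫ x, w x • gradient ψ x = - ∫ x, ψ x • G x

/-- Membership in the Sobolev space `H¹(ℝⁿ)`. -/
def MemH1 {n : ℕ} (w : Space n → ℝ) : Prop :=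
  MemLp w 2 volume ∧ ∃ G : Space n → Space n, MemLp G 2 volume ∧ IsWeakGradient w G

/-- `u ∈ C((0,T), L^p_loc(ℝⁿ))`: on every compact set `K`, `u(t)` belongs to `L^p(K)` and depends
continuously on `t ∈ (0,T)` in `L^p(K)`. -/
def ContinuousIntoLpLoc {n : ℕ} (p T : ℝ) (u : ℝ → Space n → ℝ) : Prop :=
  ∀ K : Set (Space n), IsCompact K → ∀ t ∈ Ioo 0 T,
    MemLp (u t) (ENNReal.ofReal p) (volume.restrict K) ∧
    Tendsto (fun s => eLpNorm (fun x => u s x - u t x) (ENNReal.ofReal p) (volume.restrict K))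
      (𝓝[Ioo 0 T] t) (𝓝 0)

/-- `u` is an energy solution on `[0,T)` of
`u_tt - Δu + μ / (1 + t) u_t = |u|^p`, `u(0) = ε f`, `u_t(0) = ε g`.
Here `ut` is the time derivative of `u` in `L²` and `Du` is its spatial weak gradient; as the
latter is unique, `u ∈ C([0,T), H¹)` says that `u` and `Du` are continuous into `L²`.
Test functions in `C_0^∞(ℝⁿ × [0,T))` are the restrictions to `t ≥ 0` of smooth functions on
`ℝⁿ × ℝ` with compact support in `ℝⁿ × (-∞,T)`. -/
structure IsEnergySolution {n : ℕ} (μ p ε : ℝ) (f g : Space n → ℝ) (T : ℝ)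
    (u : ℝ → Lp ℝ 2 (volume : Measure (Space n))) : Prop where
  continuousIntoLpLoc : ContinuousIntoLpLoc p T (fun t => u t)
  /-- The nonlinearity is integrable on bounded sets up to `t = 0`, so that the right-hand side of
  the weak identity makes sense. -/
  integrable_nonlinearity : ∀ K : Set (Space n), IsCompact K → ∀ t ∈ Ico 0 T,
    IntervalIntegrable (fun s => ∫ x in K, |u s x| ^ p) volume 0 t
  initial_value : u 0 =ᵐ[volume] fun x => ε * f x
  weak_form : ∃ (ut : ℝ → Lp ℝ 2 (volume : Measure (Space n)))
      (Du : ℝ → Lp (Space n) 2 (volume : Measure (Space n))),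
    ContinuousOn u (Ico 0 T) ∧
    (∀ t ∈ Ico 0 T, IsWeakGradient (u t) (Du t)) ∧
    ContinuousOn Du (Ico 0 T) ∧
    (∀ t ∈ Ico 0 T, HasDerivWithinAt u (ut t) (Ico 0 T) t) ∧
    ContinuousOn ut (Ico 0 T) ∧
    ut 0 =ᵐ[volume] (fun x => ε * g x) ∧
    ∀ φ : Space n × ℝ → ℝ, ContDiff ℝ ∞ φ → HasCompactSupport φ →
      tsupport φ ⊆ {z | z.2 < T} → ∀ t ∈ Ico 0 T,
        (∫ x, ut t x * φ (x, t)) - (∫ x, ε * g x * φ (x, 0))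
          + (∫ s in 0..t, ∫ x, (-(ut s x * deriv (fun τ => φ (x, τ)) s)
              + inner ℝ (Du s x) (gradient (fun y => φ (y, s)) x)))
          + (∫ s in 0..t, ∫ x, μ / (1 + s) * ut s x * φ (x, s))
        = ∫ s in 0..t, ∫ x, |u s x| ^ p * φ (x, s)

/-- `supp u ⊆ {(x,t) : |x| ≤ t + R}` for `u` on `[0,T)`. -/
def SupportedInCone {n : ℕ} (R T : ℝ) (u : ℝ → Lp ℝ 2 (volume : Measure (Space n))) : Prop :=
  ∀ t ∈ Ico 0 T, ∀ᵐ x, t + R < ‖x‖ → u t x = 0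

/-- The blow-up time `T_ε`: the supremum of all `T > 0` such that there is an energy solution on
`[0,T)` with support in `{|x| ≤ t + R}`. -/
def lifespan {n : ℕ} (μ p R : ℝ) (f g : Space n → ℝ) (ε : ℝ) : ℝ≥0∞ :=
  ⨆ T ∈ {T : ℝ | 0 < T ∧ ∃ u : ℝ → Lp ℝ 2 (volume : Measure (Space n)),
    IsEnergySolution μ p ε f g T u ∧ SupportedInCone R T u}, ENNReal.ofReal T

end DampedWave

end

/-! Testing the equation against a smooth function of `x` that is constant on the light cone turns
it into a one-dimensional problem: the mass `F(t) = ∫ u(t)` satisfies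
`F'' + μ / (1 + t) F' = ∫ |u(t)|^p =: N(t)`. Integrating against the factor `(1 + t)^min(μ,1)` keeps
the sign of the initial data, so that `F` grows at least like `ε t^[μ-1]₋`, and like `ε log t` if
`μ = 1`. Hölder's inequality on the ball of radius `t + R` gives `N ≥ c t^(-n(p-1)) F^p`.

Testing instead against the radial solution of `ΔΨ = Ψ`, a modified Bessel function which is
`O((1 + |x|)^(-(n-1)/2) e^|x|)`, gives a moment growing like `ε t^(-μ/2) e^t`. By Hölder's
inequality `N ≥ c ε^p t^(n-1-(n+μ-1)p/2)`, hence `F ≥ c ε^p t^(n+1-(n+μ-1)p/2)`.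

If `F ≥ L` on a dyadic interval `[σ, 2σ]`, then feeding the bound `N ≥ c t^(-n(p-1)) F^p` back into
the equation makes `F` infinite before `2σ`, unless `σ^(γ_F(p,n)) L^(p-1)` is bounded. The lower
bounds for `F` above, used as `L`, give the three lifespan estimates. -/

namespace DampedWave

/-! ### The modified Bessel series -/

/-- Taylor coefficients of the entire function `z ↦ Γ(ν/2) I_{ν/2-1}(√z) / (√z/2)^{ν/2-1}`. -/
noncomputable def besselCoeff (ν : ℝ) (k : ℕ) : ℝ :=
  ∏ j ∈ Finset.range k, (((j : ℝ) + 1) * (4 * j + 2 * ν))⁻¹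

/-- The entire solution of `4 z g'' + 2 ν g' = g`, `g(0) = 1`. For `ν = n` the function
`x ↦ g(‖x‖²)` on `ℝⁿ` is the radial solution of `Δφ = φ`, `φ(0) = 1`. -/
noncomputable def besselSeries (ν z : ℝ) : ℝ := ∑' k, besselCoeff ν k * z ^ k

section BesselSeries

variable {ν : ℝ}

theorem besselCoeff_zero (ν : ℝ) : besselCoeff ν 0 = 1 := Finset.prod_range_zero _

theorem besselCoeff_succ (ν : ℝ) (k : ℕ) :
    besselCoeff ν (k + 1) = besselCoeff ν k * (((k : ℝ) + 1) * (4 * k + 2 * ν))⁻¹ :=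
  Finset.prod_range_succ _ _

theorem besselCoeff_pos (hν : 0 < ν) (k : ℕ) : 0 < besselCoeff ν k :=
  Finset.prod_pos fun _ _ => by positivity

theorem succ_mul_besselCoeff_succ (hν : 0 < ν) (k : ℕ) :
    ((k : ℝ) + 1) * besselCoeff ν (k + 1) = besselCoeff (ν + 2) k / (2 * ν) := by
  induction k with
  | zero => simp [besselCoeff]
  | succ k ih =>
    have h : besselCoeff ν (k + 1) = besselCoeff (ν + 2) k / (2 * ν) / ((k : ℝ) + 1) := by
      rw [← ih]; field_simp
    rw [besselCoeff_succ ν (k + 1), besselCoeff_succ (ν + 2) k, h]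
    push_cast
    field_simp
    ring

theorem summable_besselSeries (hν : 0 < ν) (z : ℝ) :
    Summable fun k => besselCoeff ν k * z ^ k := by
  have hle (k : ℕ) : besselCoeff ν k ≤ (2 * ν)⁻¹ ^ k / k.factorial := by
    induction k with
    | zero => simp [besselCoeff]
    | succ k ih =>
      rw [besselCoeff_succ, Nat.factorial_succ, mul_inv]
      push_cast
      calc besselCoeff ν k * (((k : ℝ) + 1)⁻¹ * (4 * k + 2 * ν)⁻¹)
          ≤ (2 * ν)⁻¹ ^ k / k.factorial * (((k : ℝ) + 1)⁻¹ * (2 * ν)⁻¹) := by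
            gcongr
            linarith [(k.cast_nonneg : (0 : ℝ) ≤ k)]
        _ = (2 * ν)⁻¹ ^ (k + 1) / (((k : ℝ) + 1) * k.factorial) := by
            rw [pow_succ]; field_simp
  refine Summable.of_norm_bounded
    (Real.summable_pow_div_factorial ((2 * ν)⁻¹ * |z|)) fun k => ?_
  rw [norm_mul, norm_pow, Real.norm_eq_abs, Real.norm_eq_abs, abs_of_pos (besselCoeff_pos hν k),
    mul_pow, mul_div_right_comm]
  exact mul_le_mul_of_nonneg_right (hle k) (by positivity)

theorem besselSeries_zero (ν : ℝ) : besselSeries ν 0 = 1 := by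
  rw [besselSeries, tsum_eq_single 0 fun k hk => by simp [hk]]
  simp [besselCoeff]

theorem one_le_besselSeries (hν : 0 < ν) {z : ℝ} (hz : 0 ≤ z) : 1 ≤ besselSeries ν z := by
  have := (summable_besselSeries hν z).le_tsum 0 fun k _ =>
    mul_nonneg (besselCoeff_pos hν k).le (pow_nonneg hz k)
  simpa [besselCoeff_zero, besselSeries] using this

theorem hasSum_deriv_besselSeries (hν : 0 < ν) (z : ℝ) :
    HasSum (fun k : ℕ => besselCoeff ν k * (k * z ^ (k - 1)))
      (besselSeries (ν + 2) z / (2 * ν)) := by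
  have hterm (k : ℕ) : besselCoeff ν (k + 1) * ((k + 1 : ℕ) * z ^ (k + 1 - 1))
      = besselCoeff (ν + 2) k * z ^ k / (2 * ν) := by
    rw [mul_div_right_comm, ← succ_mul_besselCoeff_succ hν, Nat.add_sub_cancel]
    push_cast
    ring
  rw [← hasSum_nat_add_iff' 1]
  simp only [hterm, Finset.range_one, Finset.sum_singleton, Nat.cast_zero, zero_mul, mul_zero,
    sub_zero]
  exact (summable_besselSeries (by positivity) z).hasSum.div_const _

theorem hasDerivAt_besselSeries (hν : 0 < ν) (z : ℝ) :
    HasDerivAt (besselSeries ν) (besselSeries (ν + 2) z / (2 * ν)) z := by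
  rw [← (hasSum_deriv_besselSeries hν z).tsum_eq]
  refine hasDerivAt_tsum_of_isPreconnected
    (hasSum_deriv_besselSeries hν (|z| + 1)).summable Metric.isOpen_ball
    (convex_ball (0 : ℝ) (|z| + 1)).isPreconnected
    (fun k y _ => (hasDerivAt_pow k y).const_mul _) (fun k y hy => ?_)
    (Metric.mem_ball_self (by positivity)) (summable_besselSeries hν 0) (by simp)
  have hy' : ‖y‖ ≤ |z| + 1 := (mem_ball_zero_iff.1 hy).le
  have := (besselCoeff_pos hν k).le
  rw [norm_mul, norm_mul, norm_pow, Real.norm_natCast, Real.norm_of_nonneg this]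
  gcongr

theorem contDiff_besselSeries (hν : 0 < ν) : ContDiff ℝ ∞ (besselSeries ν) := by
  rw [contDiff_infty]
  intro m
  induction m generalizing ν with
  | zero =>
    exact contDiff_zero.2 (continuous_iff_continuousAt.2 fun z =>
      (hasDerivAt_besselSeries hν z).continuousAt)
  | succ m ih =>
    push_cast
    rw [contDiff_succ_iff_deriv, funext fun z => (hasDerivAt_besselSeries hν z).deriv]
    exact ⟨fun z => (hasDerivAt_besselSeries hν z).differentiableAt, by simp,
      (ih (by positivity)).div_const _⟩

theorem besselSeries_ode (hν : 0 < ν) (z : ℝ) :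
    z * besselSeries (ν + 2 + 2) z / (ν * (ν + 2)) + besselSeries (ν + 2) z
      = besselSeries ν z := by
  have hν2 : 0 < ν + 2 := by positivity
  have sum2 := summable_besselSeries hν2 z
  have sum4 := summable_besselSeries (add_pos hν2 two_pos) z
  rw [besselSeries, besselSeries, besselSeries, sum2.tsum_eq_zero_add,
    (summable_besselSeries hν z).tsum_eq_zero_add, mul_div_right_comm, ← tsum_mul_left,
    besselCoeff_zero, besselCoeff_zero, add_left_comm,
    ← Summable.tsum_add (sum4.mul_left _) ((summable_nat_add_iff 1).2 sum2)]
  congr 2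
  ext k
  have h1 : besselCoeff ν (k + 1) = besselCoeff (ν + 2) k / (2 * ν) / ((k : ℝ) + 1) := by
    rw [← succ_mul_besselCoeff_succ hν]; field_simp
  have h2 : besselCoeff (ν + 2 + 2) k
      = ((k : ℝ) + 1) * besselCoeff (ν + 2) (k + 1) * (2 * (ν + 2)) := by
    rw [succ_mul_besselCoeff_succ hν2]; field_simp
  rw [h2, h1, besselCoeff_succ (ν + 2), pow_succ]
  field_simp
  ring

theorem besselCoeff_sq_mul_factorial_le (m k : ℕ) :
    besselCoeff (m + 1) k ^ 2 * (2 * k).factorial * (2 * k + m).factorial ≤ m.factorial := by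
  induction k with
  | zero => simp [besselCoeff]
  | succ k ih =>
    refine le_trans ?_ ih
    set P := besselCoeff (m + 1) k ^ 2 * ((2 * k).factorial : ℝ) * ((2 * k + m).factorial : ℝ)
    have hstep : besselCoeff (m + 1) (k + 1) ^ 2 * (2 * (k + 1)).factorial
        * (2 * (k + 1) + m).factorial
        = P * (((2 * k + 1) * (2 * k + m + 2)) / ((2 * k + 2) * (2 * k + m + 1))) := by
      rw [besselCoeff_succ, show 2 * (k + 1) = 2 * k + 1 + 1 by ring,
        show 2 * k + 1 + 1 + m = 2 * k + m + 1 + 1 by ring]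
      simp only [Nat.factorial_succ]
      push_cast
      simp only [P]
      field_simp
      ring
    rw [hstep]
    refine mul_le_of_le_one_right (by positivity) ((div_le_one (by positivity)).2 ?_)
    nlinarith [(k.cast_nonneg : (0 : ℝ) ≤ k), (m.cast_nonneg : (0 : ℝ) ≤ m)]

theorem tsum_even_shift_le_exp (m : ℕ) {r : ℝ} (hr : 0 ≤ r) :
    (Summable fun k : ℕ => r ^ (2 * k + m) / (2 * k + m).factorial) ∧
      ∑' k : ℕ, r ^ (2 * k + m) / (2 * k + m).factorial ≤ Real.exp r := by
  have hs := Real.summable_pow_div_factorial r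
  have hinj : Function.Injective fun k : ℕ => 2 * k + m := fun a b h => by
    simp only at h; omega
  refine ⟨hs.comp_injective hinj, ?_⟩
  rw [Real.exp_eq_exp_ℝ, NormedSpace.exp_eq_tsum_div]
  exact Summable.tsum_le_tsum_of_inj _ hinj (fun c _ => by positivity) (fun k => le_rfl)
    (hs.comp_injective hinj) hs

theorem one_add_pow_mul_tsum_le_exp (m : ℕ) {r : ℝ} (hr : 0 ≤ r) :
    (Summable fun k : ℕ => r ^ (2 * k) / (2 * k + m).factorial) ∧
      (1 + r) ^ m * ∑' k : ℕ, r ^ (2 * k) / (2 * k + m).factorial ≤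
        2 ^ (m + 1) * Real.exp r := by
  obtain ⟨sum0, le0⟩ := tsum_even_shift_le_exp 0 hr
  obtain ⟨-, leM⟩ := tsum_even_shift_le_exp m hr
  simp only [add_zero] at sum0 le0
  have hle (k : ℕ) : r ^ (2 * k) / (2 * k + m).factorial ≤ r ^ (2 * k) / (2 * k).factorial := by
    gcongr; omega
  have hsum := Summable.of_nonneg_of_le (fun k => by positivity) hle sum0
  refine ⟨hsum, ?_⟩
  have hpow : (1 + r) ^ m ≤ 2 ^ m * (1 + r ^ m) := by
    refine (add_pow_le zero_le_one hr m).trans ?_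
    rw [one_pow]
    gcongr
    exacts [one_le_two, m.sub_le 1]
  have hshift : r ^ m * ∑' k : ℕ, r ^ (2 * k) / (2 * k + m).factorial
      = ∑' k : ℕ, r ^ (2 * k + m) / (2 * k + m).factorial := by
    rw [← tsum_mul_left]
    exact tsum_congr fun k => by ring
  calc _ ≤ 2 ^ m * (1 + r ^ m) * ∑' k : ℕ, r ^ (2 * k) / (2 * k + m).factorial :=
        mul_le_mul_of_nonneg_right hpow (tsum_nonneg fun k => by positivity)
    _ = 2 ^ m * (∑' k : ℕ, r ^ (2 * k) / (2 * k + m).factorial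
          + ∑' k : ℕ, r ^ (2 * k + m) / (2 * k + m).factorial) := by rw [← hshift]; ring
    _ ≤ 2 ^ m * (Real.exp r + Real.exp r) := by
        gcongr
        exact (hsum.tsum_le_tsum hle sum0).trans le0
    _ = 2 ^ (m + 1) * Real.exp r := by ring

-- AM-GM replaces the product bound on the coefficients by a sum of two exponential series.
theorem two_mul_besselCoeff_le (m k : ℕ) {l : ℝ} (hl : 0 < l) :
    2 * besselCoeff (m + 1) k ≤
      l / (2 * k).factorial + l⁻¹ * m.factorial / (2 * k + m).factorial := by
  set a := besselCoeff (m + 1) k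
  set P : ℝ := ((2 * k).factorial : ℝ)
  have hP : 0 < P := by positivity
  have hsq : a ^ 2 * P ≤ m.factorial / (2 * k + m).factorial :=
    (le_div_iff₀ (by positivity)).2 (besselCoeff_sq_mul_factorial_le m k)
  have hamgm : 0 ≤ l / P + l⁻¹ * (a ^ 2 * P) - 2 * a := by
    have : l / P + l⁻¹ * (a ^ 2 * P) - 2 * a = (l - a * P) ^ 2 / (l * P) := by
      field_simp; ring
    rw [this]; positivity
  have := mul_le_mul_of_nonneg_left hsq (inv_pos.2 hl).le
  rw [mul_div_assoc]
  linarith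

theorem besselSeries_le_exp (m : ℕ) {r : ℝ} (hr : 0 ≤ r) :
    besselSeries (m + 1) (r ^ 2)
      ≤ (1 + m.factorial * 2 ^ (m + 1)) / 2 * (1 + r) ^ (-(m : ℝ) / 2) * Real.exp r := by
  obtain ⟨sum0, le0⟩ := tsum_even_shift_le_exp 0 hr
  obtain ⟨sumM, leM⟩ := one_add_pow_mul_tsum_le_exp m hr
  simp only [add_zero] at sum0 le0
  have h1r : 0 < 1 + r := by positivity
  set l : ℝ := (1 + r) ^ (-(m : ℝ) / 2) with hl
  have hl0 : 0 < l := Real.rpow_pos_of_pos h1r _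
  have hll : l * l * (1 + r) ^ m = 1 := by
    rw [hl, ← Real.rpow_natCast, ← Real.rpow_add h1r, ← Real.rpow_add h1r]
    ring_nf
    exact Real.rpow_zero _
  have hlM : l⁻¹ * ∑' k : ℕ, r ^ (2 * k) / (2 * k + m).factorial
      ≤ l * (2 ^ (m + 1) * Real.exp r) := by
    rw [inv_mul_le_iff₀ hl0]
    calc _ = l * l * ((1 + r) ^ m * ∑' k : ℕ, r ^ (2 * k) / (2 * k + m).factorial) := by
          rw [← mul_assoc, hll, one_mul]
      _ ≤ _ := by rw [← mul_assoc l l]; gcongr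
  have hterm (k : ℕ) : besselCoeff (m + 1) k * (r ^ 2) ^ k
      ≤ l / 2 * (r ^ (2 * k) / (2 * k).factorial)
        + l⁻¹ * m.factorial / 2 * (r ^ (2 * k) / (2 * k + m).factorial) := by
    have := mul_le_mul_of_nonneg_right (two_mul_besselCoeff_le m k hl0)
      (pow_nonneg hr (2 * k))
    rw [← pow_mul]
    linear_combination this / 2
  calc besselSeries (m + 1) (r ^ 2)
      ≤ l / 2 * ∑' k : ℕ, r ^ (2 * k) / (2 * k).factorial
        + l⁻¹ * m.factorial / 2 * ∑' k : ℕ, r ^ (2 * k) / (2 * k + m).factorial := by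
        rw [besselSeries, ← tsum_mul_left, ← tsum_mul_left,
          ← (sum0.mul_left _).tsum_add (sumM.mul_left _)]
        exact (summable_besselSeries (by positivity) _).tsum_le_tsum hterm
          ((sum0.mul_left _).add (sumM.mul_left _))
    _ = l / 2 * ∑' k : ℕ, r ^ (2 * k) / (2 * k).factorial + m.factorial / 2 *
          (l⁻¹ * ∑' k : ℕ, r ^ (2 * k) / (2 * k + m).factorial) := by ring
    _ ≤ l / 2 * Real.exp r + m.factorial / 2 * (l * (2 ^ (m + 1) * Real.exp r)) := by gcongr
    _ = _ := by ring

end BesselSeries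

/-! ### Differential inequalities -/

section Comparison

theorem rpow_le_rpow_abs_mul_rpow {x y k : ℝ} (hx : 0 < x) (hy : 0 < y) (hxy : x ≤ k * y)
    (hyx : y ≤ k * x) (a : ℝ) : x ^ a ≤ k ^ |a| * y ^ a := by
  have hk : 0 ≤ k := nonneg_of_mul_nonneg_left (hx.le.trans hxy) hy
  rcases le_total 0 a with ha | ha
  · rw [abs_of_nonneg ha, ← Real.mul_rpow hk hy.le]
    exact Real.rpow_le_rpow hx.le hxy ha
  · have hneg := Real.rpow_le_rpow hy.le hyx (neg_nonneg.2 ha)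
    rw [Real.mul_rpow hk hx.le, Real.rpow_neg hy.le, Real.rpow_neg hx.le,
      inv_le_iff_one_le_mul₀ (by positivity), mul_right_comm, ← div_eq_mul_inv,
      one_le_div (by positivity)] at hneg
    rwa [abs_of_nonpos ha]

theorem monotoneOn_Icc_of_hasDerivWithinAt {f f' : ℝ → ℝ} {a c : ℝ}
    (hf : ∀ t ∈ Icc a c, HasDerivWithinAt f (f' t) (Icc a c) t)
    (hf' : ∀ t ∈ Ioo a c, 0 ≤ f' t) : MonotoneOn f (Icc a c) := by
  refine monotoneOn_of_hasDerivWithinAt_nonneg (f' := f') (convex_Icc a c)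
    (fun t ht => (hf t ht).continuousWithinAt)
    (fun t ht => (hf t (interior_subset ht)).mono interior_subset) (fun t ht => ?_)
  rw [interior_Icc] at ht
  exact hf' t ht

end Comparison

section Supersolution

/-- The flux `(1+t)^b H' + d H` with `b = min(μ,1)`, `d = [μ-1]₊` of a function `H` with derivative
`H₁`. As `b + d = μ`, and `b = 1` unless `d = 0`, its derivative is
`(1+t)^b (H'' + μ/(1+t) H')`. -/
noncomputable def flux (μ : ℝ) (H H₁ : ℝ → ℝ) (t : ℝ) : ℝ :=
  (1 + t) ^ min μ 1 * H₁ t + (μ - 1)⁺ * H t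

/-- A supersolution on `[0,τ]` of `H'' + μ/(1+t) H' = S` with `H(0) ≥ 0` and initial flux at least
`q`, in integrated form; `H₁` is the derivative of `H`. -/
structure IsSupersolution (μ q τ : ℝ) (S H H₁ : ℝ → ℝ) : Prop where
  hasDerivWithinAt : ∀ t ∈ Icc 0 τ, HasDerivWithinAt H (H₁ t) (Icc 0 τ) t
  continuousOn_deriv : ContinuousOn H₁ (Icc 0 τ)
  init_nonneg : 0 ≤ H 0
  source_nonneg : ∀ t ∈ Icc 0 τ, 0 ≤ H t → 0 ≤ S t
  le_flux : ∀ t ∈ Icc 0 τ, q + ∫ s in 0..t, (1 + s) ^ min μ 1 * S s ≤ flux μ H H₁ t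

theorem min_one_add_posPart_sub_one (μ : ℝ) : min μ 1 + (μ - 1)⁺ = μ := by
  rw [posPart_def]
  rcases le_total μ 1 with h | h
  · rw [min_eq_left h, sup_eq_right.2 (by linarith), add_zero]
  · rw [min_eq_right h, sup_eq_left.2 (by linarith)]
    ring

theorem posPart_sub_one_mul_rpow (μ x : ℝ) : (μ - 1)⁺ * x ^ (min μ 1 - 1) = (μ - 1)⁺ := by
  rcases le_total μ 1 with h | h
  · rw [posPart_eq_zero.2 (by linarith), zero_mul]
  · rw [min_eq_right h, sub_self, Real.rpow_zero, mul_one]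

theorem hasDerivAt_one_add_rpow (a : ℝ) {t : ℝ} (ht : 0 < 1 + t) :
    HasDerivAt (fun s : ℝ => (1 + s) ^ a) (a * (1 + t) ^ (a - 1)) t := by
  simpa using ((hasDerivAt_id t).const_add 1).rpow_const (p := a) (Or.inl ht.ne')

theorem continuousOn_one_add_rpow (a τ : ℝ) :
    ContinuousOn (fun s : ℝ => (1 + s) ^ a) (Icc 0 τ) :=
  fun _ ht => (hasDerivAt_one_add_rpow a (by linarith [ht.1])).continuousAt.continuousWithinAt

namespace IsSupersolution

variable {μ q τ : ℝ} {S H H₁ : ℝ → ℝ}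

theorem hasDerivWithinAt_rpow_mul (h : IsSupersolution μ q τ S H H₁) {t : ℝ} (ht : t ∈ Icc 0 τ) :
    HasDerivWithinAt (fun s => (1 + s) ^ (μ - 1)⁺ * H s)
      ((1 + t) ^ ((μ - 1)⁺ - min μ 1) * flux μ H H₁ t) (Icc 0 τ) t := by
  have h0 : 0 < 1 + t := by linarith [ht.1]
  refine ((hasDerivAt_one_add_rpow _ h0).hasDerivWithinAt.mul
    (h.hasDerivWithinAt t ht)).congr_deriv ?_
  have hpow : (1 + t) ^ ((μ - 1)⁺ - min μ 1) * (1 + t) ^ (min μ 1 - 1)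
      = (1 + t) ^ ((μ - 1)⁺ - 1) := by
    rw [← Real.rpow_add h0]; ring_nf
  rw [flux, mul_add, ← mul_assoc, ← Real.rpow_add h0, sub_add_cancel, ← hpow]
  linear_combination (1 + t) ^ ((μ - 1)⁺ - min μ 1) * H t * posPart_sub_one_mul_rpow μ (1 + t)

theorem continuousOn (h : IsSupersolution μ q τ S H H₁) : ContinuousOn H (Icc 0 τ) :=
  fun t ht => (h.hasDerivWithinAt t ht).continuousWithinAt

theorem continuousOn_flux (h : IsSupersolution μ q τ S H H₁) :
    ContinuousOn (flux μ H H₁) (Icc 0 τ) :=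
  ((continuousOn_one_add_rpow _ τ).mul h.continuousOn_deriv).add
    (continuousOn_const.mul h.continuousOn)

theorem le_rpow_mul_of_deriv_le (h : IsSupersolution μ q τ S H H₁) {a t : ℝ} (ha : 0 ≤ a)
    (hat : a ≤ t) (ht : t ≤ τ) (hHa : 0 ≤ H a) {G G' : ℝ → ℝ} (hGa : G a = 0)
    (hG : ∀ s ∈ Icc a t, HasDerivAt G (G' s) s)
    (hG' : ∀ s ∈ Ioo a t, G' s ≤ (1 + s) ^ ((μ - 1)⁺ - min μ 1) * flux μ H H₁ s) :
    G t ≤ (1 + t) ^ (μ - 1)⁺ * H t := by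
  have hsub : Icc a t ⊆ Icc 0 τ := Icc_subset_Icc ha ht
  have hmono := monotoneOn_Icc_of_hasDerivWithinAt
    (fun s hs => ((h.hasDerivWithinAt_rpow_mul (hsub hs)).mono hsub).sub
      (hG s hs).hasDerivWithinAt)
    (fun s hs => sub_nonneg.2 (hG' s hs))
  have hle := hmono (left_mem_Icc.2 hat) (right_mem_Icc.2 hat) hat
  have hinit : 0 ≤ (1 + a) ^ (μ - 1)⁺ * H a :=
    mul_nonneg (Real.rpow_nonneg (by linarith) _) hHa
  simp only [Pi.sub_apply, hGa, sub_zero] at hle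
  linarith

theorem nonneg_of_flux_nonneg (h : IsSupersolution μ q τ S H H₁) {t : ℝ} (ht : t ∈ Icc 0 τ)
    (hflux : ∀ s ∈ Ioo 0 t, 0 ≤ flux μ H H₁ s) : 0 ≤ H t := by
  have h0 : 0 < 1 + t := by linarith [ht.1]
  have := h.le_rpow_mul_of_deriv_le le_rfl ht.1 ht.2 h.init_nonneg (G := fun _ => 0) rfl
    (fun s _ => hasDerivAt_const s 0)
    (fun s hs => mul_nonneg (Real.rpow_nonneg (by linarith [hs.1]) _) (hflux s hs))
  exact nonneg_of_mul_nonneg_right this (by positivity)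

theorem le_flux_of_nonneg (h : IsSupersolution μ q τ S H H₁) {t : ℝ} (ht : t ∈ Icc 0 τ)
    (hH : ∀ s ∈ Icc 0 t, 0 ≤ H s) : q ≤ flux μ H H₁ t := by
  refine le_trans (le_add_of_nonneg_right ?_) (h.le_flux t ht)
  exact intervalIntegral.integral_nonneg ht.1 fun s hs =>
    mul_nonneg (Real.rpow_nonneg (by linarith [hs.1]) _)
      (h.source_nonneg s ⟨hs.1, hs.2.trans ht.2⟩ (hH s hs))

-- At the first zero of the flux `H` is still nonnegative, so the flux is at least `q` there.
theorem flux_pos (h : IsSupersolution μ q τ S H H₁) (hq : 0 < q) {t : ℝ} (ht : t ∈ Icc 0 τ) :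
    0 < flux μ H H₁ t := by
  by_contra! hneg
  have hcompact : IsCompact (Icc 0 τ ∩ flux μ H H₁ ⁻¹' Iic 0) :=
    isCompact_Icc.of_isClosed_subset
      (h.continuousOn_flux.preimage_isClosed_of_isClosed isClosed_Icc isClosed_Iic)
      inter_subset_left
  obtain ⟨s, ⟨hs, hsneg⟩, hfirst⟩ := hcompact.exists_isLeast ⟨t, ht, hneg⟩
  have hbefore (r : ℝ) (hr : r ∈ Ico 0 s) : 0 < flux μ H H₁ r := by
    by_contra! hr'
    exact (hfirst ⟨⟨hr.1, hr.2.le.trans hs.2⟩, hr'⟩).not_gt hr.2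
  have hge : q ≤ flux μ H H₁ s := h.le_flux_of_nonneg hs fun r hr =>
    h.nonneg_of_flux_nonneg ⟨hr.1, hr.2.trans hs.2⟩ fun r' hr' =>
      (hbefore r' ⟨hr'.1.le, hr'.2.trans_le hr.2⟩).le
  exact (hq.trans_le hge).not_ge hsneg

theorem nonneg (h : IsSupersolution μ q τ S H H₁) (hq : 0 < q) {t : ℝ} (ht : t ∈ Icc 0 τ) :
    0 ≤ H t :=
  h.nonneg_of_flux_nonneg ht fun _ hs => (h.flux_pos hq ⟨hs.1.le, hs.2.le.trans ht.2⟩).le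

theorem source_nonneg' (h : IsSupersolution μ q τ S H H₁) (hq : 0 < q) {t : ℝ}
    (ht : t ∈ Icc 0 τ) : 0 ≤ S t :=
  h.source_nonneg t ht (h.nonneg hq ht)

theorem const_le_flux (h : IsSupersolution μ q τ S H H₁) (hq : 0 < q) {t : ℝ}
    (ht : t ∈ Icc 0 τ) : q ≤ flux μ H H₁ t :=
  h.le_flux_of_nonneg ht fun _ hs => h.nonneg hq ⟨hs.1, hs.2.trans ht.2⟩

theorem const_mul_rpow_le (h : IsSupersolution μ q τ S H H₁) (hq : 0 < q) {t : ℝ} (ht1 : 1 ≤ t)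
    (ht : t ≤ τ) :
    q * (1 + t) ^ (1 - min μ 1) ≤ 4 * 2 ^ |(μ - 1)⁺ - min μ 1| * H t := by
  set e := (μ - 1)⁺ - min μ 1 with he
  have hweight (s : ℝ) (hs : s ∈ Ioo (t / 2) t) : (1 + t) ^ e ≤ 2 ^ |e| * (1 + s) ^ e :=
    rpow_le_rpow_abs_mul_rpow (by linarith) (by linarith [hs.1]) (by linarith [hs.1])
      (by linarith [hs.2]) e
  have key := h.le_rpow_mul_of_deriv_le (a := t / 2) (by linarith) (by linarith) ht
    (h.nonneg hq ⟨by linarith, by linarith⟩)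
    (G := fun s => (1 + t) ^ e / 2 ^ |e| * q * (s - t / 2)) (by simp)
    (fun s _ => ((hasDerivAt_id s).sub_const _).const_mul _) (fun s hs => by
      have hs0 : 0 < s := by linarith [hs.1]
      rw [mul_one]
      exact mul_le_mul ((div_le_iff₀' (by positivity)).2 (hweight s hs))
        (h.const_le_flux hq ⟨hs0.le, hs.2.le.trans ht⟩) hq.le (by positivity))
  have hpow : (1 + t) ^ e * (1 + t) = (1 + t) ^ (μ - 1)⁺ * (1 + t) ^ (1 - min μ 1) := by
    rw [← Real.rpow_add (by linarith), ← Real.rpow_add_one (by linarith), he]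
    ring_nf
  refine le_of_mul_le_mul_left ?_ (show 0 < (1 + t) ^ (μ - 1)⁺ by positivity)
  calc (1 + t) ^ (μ - 1)⁺ * (q * (1 + t) ^ (1 - min μ 1))
      = (1 + t) ^ e * q * (1 + t) := by linear_combination -q * hpow
    _ ≤ (1 + t) ^ e * q * (4 * (t - t / 2)) := by gcongr; linarith
    _ = 4 * 2 ^ |e| * ((1 + t) ^ e / 2 ^ |e| * q * (t - t / 2)) := by field_simp
    _ ≤ 4 * 2 ^ |e| * ((1 + t) ^ (μ - 1)⁺ * H t) := by gcongr
    _ = _ := by ring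

theorem const_mul_log_le (h : IsSupersolution 1 q τ S H H₁) (hq : 0 < q) {t : ℝ}
    (ht : t ∈ Icc 0 τ) : q * Real.log (1 + t) ≤ H t := by
  have key := h.le_rpow_mul_of_deriv_le le_rfl ht.1 ht.2 h.init_nonneg
    (G := fun s => q * Real.log (1 + s)) (by simp)
    (fun s hs => (((hasDerivAt_id s).const_add 1).log (by
      simp only [id_eq]; linarith [hs.1])).const_mul q)
    (fun s hs => by
      have h1 := h.const_le_flux hq ⟨hs.1.le, hs.2.le.trans ht.2⟩
      have h0 : 0 < 1 + s := by linarith [hs.1]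
      simp only [sub_self, posPart_zero, min_self, zero_sub, Real.rpow_neg_one, id_eq]
      rw [mul_one_div, div_eq_inv_mul]
      gcongr)
  simpa using key

theorem le_flux_of_le_source (h : IsSupersolution μ q τ S H H₁) (hq : 0 < q)
    (hS : IntervalIntegrable S volume 0 τ) {a t ν : ℝ} (ha : 0 ≤ a) (hta : t ≤ 2 * a)
    (ht : t ≤ τ) (hν : 0 ≤ ν) (hSν : ∀ s ∈ Icc a t, ν ≤ S s) {s : ℝ} (hs : s ∈ Icc a t) :
    (1 + t) ^ min μ 1 / 2 ^ |min μ 1| * ν * (s - a) ≤ flux μ H H₁ s := by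
  have hs0 : 0 ≤ s := ha.trans hs.1
  have hsτ : s ≤ τ := hs.2.trans ht
  set F : ℝ → ℝ := fun r => (1 + r) ^ min μ 1 * S r
  have hint (c e : ℝ) (hc : 0 ≤ c) (hce : c ≤ e) (he : e ≤ s) :
      IntervalIntegrable F volume c e := by
    have hsub : uIcc c e ⊆ Icc 0 τ := by
      rw [uIcc_of_le hce]
      exact Icc_subset_Icc hc (he.trans hsτ)
    refine (hS.mono_set ?_).continuousOn_mul ((continuousOn_one_add_rpow _ τ).mono hsub)
    rwa [uIcc_of_le (hs0.trans hsτ)]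
  have hpast : 0 ≤ ∫ r in 0..a, F r :=
    intervalIntegral.integral_nonneg ha fun r hr =>
      mul_nonneg (Real.rpow_nonneg (by linarith [hr.1]) _)
        (h.source_nonneg' hq ⟨hr.1, by linarith [hr.2, hs.1]⟩)
  have hrecent : (∫ _ in a..s, (1 + t) ^ min μ 1 / 2 ^ |min μ 1| * ν) ≤ ∫ r in a..s, F r := by
    refine intervalIntegral.integral_mono_on hs.1 (by simp) (hint a s ha hs.1 le_rfl)
      fun r hr => ?_
    have hr0 : 0 ≤ r := ha.trans hr.1
    refine mul_le_mul ?_ (hSν r ⟨hr.1, hr.2.trans hs.2⟩) hν (by positivity)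
    rw [div_le_iff₀' (by positivity)]
    exact rpow_le_rpow_abs_mul_rpow (by linarith [hr.2, hs.2]) (by linarith)
      (by linarith [hr.1]) (by linarith [hr.2, hs.2]) _
  rw [intervalIntegral.integral_const, smul_eq_mul] at hrecent
  have hflux := h.le_flux s ⟨hs0, hsτ⟩
  rw [← intervalIntegral.integral_add_adjacent_intervals (hint 0 a le_rfl ha hs.1)
    (hint a s ha hs.1 le_rfl)] at hflux
  linarith

theorem const_mul_sq_le_of_le_source (h : IsSupersolution μ q τ S H H₁) (hq : 0 < q)
    (hS : IntervalIntegrable S volume 0 τ) {a t ν : ℝ} (ha : 0 ≤ a) (hat : a ≤ t)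
    (hta : t ≤ 2 * a) (ht : t ≤ τ) (hν : 0 ≤ ν) (hSν : ∀ s ∈ Icc a t, ν ≤ S s) :
    ν * (t - a) ^ 2 ≤ 2 * (2 ^ |min μ 1| * 2 ^ |(μ - 1)⁺ - min μ 1|) * H t := by
  set b := min μ 1
  set e := (μ - 1)⁺ - b with he
  have h1t : 0 < 1 + t := by linarith
  have hsplit : (1 + t) ^ (μ - 1)⁺ = (1 + t) ^ e * (1 + t) ^ b := by
    rw [← Real.rpow_add h1t, he, sub_add_cancel]
  set c := (1 + t) ^ (μ - 1)⁺ * ν / (2 ^ |b| * 2 ^ |e|) with hc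
  have key := h.le_rpow_mul_of_deriv_le ha hat ht (h.nonneg hq ⟨ha, hat.trans ht⟩)
    (G := fun s => c / 2 * (s - a) ^ 2) (by simp)
    (fun s _ => (((hasDerivAt_id s).sub_const a).pow 2).const_mul _) (fun s hs => by
      have hs0 : 0 ≤ s := ha.trans hs.1.le
      have hflux := h.le_flux_of_le_source hq hS ha hta ht hν hSν ⟨hs.1.le, hs.2.le⟩
      have hweight : (1 + t) ^ e / 2 ^ |e| ≤ (1 + s) ^ e := by
        rw [div_le_iff₀' (by positivity)]
        exact rpow_le_rpow_abs_mul_rpow h1t (by linarith) (by linarith [hs.1])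
          (by linarith [hs.2]) e
      have hsa : 0 ≤ s - a := by linarith [hs.1]
      refine le_trans (le_of_eq ?_) (mul_le_mul hweight hflux (by positivity) (by positivity))
      rw [hc, hsplit]
      simp only [id_eq]
      field_simp
      ring)
  refine le_of_mul_le_mul_left ?_ (show 0 < (1 + t) ^ (μ - 1)⁺ by positivity)
  calc (1 + t) ^ (μ - 1)⁺ * (ν * (t - a) ^ 2)
      = 2 * (2 ^ |b| * 2 ^ |e|) * (c / 2 * (t - a) ^ 2) := by rw [hc]; field_simp
    _ ≤ 2 * (2 ^ |b| * 2 ^ |e|) * ((1 + t) ^ (μ - 1)⁺ * H t) := by gcongr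
    _ = _ := by ring

end IsSupersolution

end Supersolution

section ExponentialGrowth

variable {μ q τ : ℝ} {H H₁ : ℝ → ℝ}

theorem hasDerivAt_flux {y y' y'' : ℝ → ℝ} {t : ℝ} (ht : 0 < 1 + t)
    (hy : HasDerivAt y (y' t) t) (hy' : HasDerivAt y' (y'' t) t) :
    HasDerivAt (flux μ y y') ((1 + t) ^ min μ 1 * (y'' t + μ / (1 + t) * y' t)) t := by
  refine (((hasDerivAt_one_add_rpow (min μ 1) ht).mul hy').add
    (hy.const_mul (μ - 1)⁺)).congr_deriv ?_
  have hpow : (1 + t) ^ (min μ 1 - 1) = (1 + t) ^ min μ 1 / (1 + t) := Real.rpow_sub_one ht.ne' _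
  have hd := posPart_sub_one_mul_rpow μ (1 + t)
  have hμ := min_one_add_posPart_sub_one μ
  rw [hpow] at hd ⊢
  generalize (μ - 1)⁺ = d at *
  generalize min μ 1 = b at *
  subst hμ
  linear_combination -y' t * hd

theorem flux_sub_flux_le_integral {y y' y'' : ℝ → ℝ}
    (hy : ∀ t ∈ Icc 0 τ, HasDerivAt y (y' t) t) (hy' : ∀ t ∈ Icc 0 τ, HasDerivAt y' (y'' t) t)
    (hsub : ∀ t ∈ Icc 0 τ, y'' t + μ / (1 + t) * y' t ≤ y t) {t : ℝ} (ht : t ∈ Icc 0 τ) :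
    flux μ y y' t - flux μ y y' 0 ≤ ∫ s in 0..t, (1 + s) ^ min μ 1 * y s := by
  have hle {s : ℝ} (hs : s ∈ Icc 0 t) : s ∈ Icc 0 τ := ⟨hs.1, hs.2.trans ht.2⟩
  have hderiv {s : ℝ} (hs : s ∈ Icc 0 t) := hasDerivAt_flux (μ := μ)
    (by linarith [hs.1] : 0 < 1 + s) (hy s (hle hs)) (hy' s (hle hs))
  have hyc : ContinuousOn y (Icc 0 t) := fun s hs =>
    (hy s (hle hs)).continuousAt.continuousWithinAt
  exact intervalIntegral.sub_le_integral_of_hasDeriv_right_of_le ht.1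
    (fun s hs => (hderiv hs).continuousAt.continuousWithinAt)
    (fun s hs => (hderiv (Ioo_subset_Icc_self hs)).hasDerivWithinAt)
    ((continuousOn_one_add_rpow _ t).mul hyc).integrableOn_Icc
    (fun s hs => mul_le_mul_of_nonneg_left (hsub s (hle (Ioo_subset_Icc_self hs)))
      (Real.rpow_nonneg (by linarith [hs.1]) _))

theorem IsSupersolution.sub_subsolution (h : IsSupersolution μ q τ H H H₁) {y y' y'' : ℝ → ℝ}
    (hy : ∀ t ∈ Icc 0 τ, HasDerivAt y (y' t) t) (hy' : ∀ t ∈ Icc 0 τ, HasDerivAt y' (y'' t) t)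
    (hsub : ∀ t ∈ Icc 0 τ, y'' t + μ / (1 + t) * y' t ≤ y t) (hy0 : y 0 = 0) :
    IsSupersolution μ (q - y' 0) τ (fun t => H t - y t) (fun t => H t - y t)
      (fun t => H₁ t - y' t) where
  hasDerivWithinAt t ht := (h.hasDerivWithinAt t ht).sub (hy t ht).hasDerivWithinAt
  continuousOn_deriv := h.continuousOn_deriv.sub fun t ht =>
    (hy' t ht).continuousAt.continuousWithinAt
  init_nonneg := by simpa [hy0] using h.init_nonneg
  source_nonneg _ _ := id
  le_flux t ht := by
    have hint {F : ℝ → ℝ} (hF : ContinuousOn F (Icc 0 τ)) :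
        IntervalIntegrable (fun s => (1 + s) ^ min μ 1 * F s) volume 0 t := by
      refine ContinuousOn.intervalIntegrable_of_Icc ht.1 ?_
      exact ((continuousOn_one_add_rpow _ τ).mul hF).mono (Icc_subset_Icc_right ht.2)
    have hflux := flux_sub_flux_le_integral hy hy' hsub ht
    have hflux0 : flux μ y y' 0 = y' 0 := by simp [flux, hy0]
    simp only [mul_sub]
    rw [intervalIntegral.integral_sub (hint h.continuousOn) (hint fun s hs =>
      (hy s hs).continuousAt.continuousWithinAt)]
    have := h.le_flux t ht
    simp only [flux] at *
    linarith

theorem IsSupersolution.subsolution_le (h : IsSupersolution μ q τ H H H₁) {y y' y'' : ℝ → ℝ}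
    (hy : ∀ t ∈ Icc 0 τ, HasDerivAt y (y' t) t) (hy' : ∀ t ∈ Icc 0 τ, HasDerivAt y' (y'' t) t)
    (hsub : ∀ t ∈ Icc 0 τ, y'' t + μ / (1 + t) * y' t ≤ y t)
    (hy0 : y 0 = 0) (hy'0 : y' 0 < q) {t : ℝ} (ht : t ∈ Icc 0 τ) : y t ≤ H t :=
  sub_nonneg.1 ((h.sub_subsolution hy hy' hsub hy0).nonneg (sub_pos.2 hy'0) ht)

theorem hasDerivAt_one_add_rpow_mul (a : ℝ) {w : ℝ → ℝ} {w₁ t : ℝ} (ht : 0 < 1 + t)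
    (hw : HasDerivAt w w₁ t) :
    HasDerivAt (fun s => (1 + s) ^ a * w s) ((1 + t) ^ a * (w₁ + a / (1 + t) * w t)) t := by
  refine ((hasDerivAt_one_add_rpow a ht).mul hw).congr_deriv ?_
  rw [Real.rpow_sub_one ht.ne']
  ring

theorem hasDerivAt_liouville (a : ℝ) {w w' w'' : ℝ → ℝ} {t : ℝ} (ht : 0 < 1 + t)
    (hw : HasDerivAt w (w' t) t) (hw' : HasDerivAt w' (w'' t) t) :
    HasDerivAt (fun s => (1 + s) ^ a * (w' s + a / (1 + s) * w s))
      ((1 + t) ^ a * (w'' t + 2 * a / (1 + t) * w' t + (a ^ 2 - a) / (1 + t) ^ 2 * w t)) t := by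
  have hinv : HasDerivAt (fun s : ℝ => a / (1 + s)) (-(a / (1 + t) ^ 2)) t := by
    refine ((hasDerivAt_const t a).div ((hasDerivAt_id t).const_add 1) ht.ne').congr_deriv ?_
    simp only [id_eq]
    ring
  refine (hasDerivAt_one_add_rpow_mul a ht (hw'.add (hinv.mul hw))).congr_deriv ?_
  simp only [Pi.add_apply, Pi.mul_apply]
  field_simp
  ring

/-- A subsolution of `w'' = (1 + κ/(1+t)²) w` on `[0,∞)`, for every `κ ≥ -1/4`, that vanishes at
`0` and grows like `exp`. -/
noncomputable def growthProfile (t : ℝ) : ℝ :=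
  Real.exp t * (1 + 2 / (2 + t)) - 2 * Real.exp (-t)

/-- The derivative of `growthProfile`. -/
noncomputable def growthProfile' (t : ℝ) : ℝ :=
  Real.exp t * (1 + 2 / (2 + t) - 2 / (2 + t) ^ 2) + 2 * Real.exp (-t)

/-- The second derivative of `growthProfile`. -/
noncomputable def growthProfile'' (t : ℝ) : ℝ :=
  Real.exp t * (1 + 2 / (2 + t) - 4 / (2 + t) ^ 2 + 4 / (2 + t) ^ 3) - 2 * Real.exp (-t)

theorem hasDerivAt_exp_neg (t : ℝ) : HasDerivAt (fun s => Real.exp (-s)) (-Real.exp (-t)) t := by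
  simpa using (hasDerivAt_neg t).exp

theorem hasDerivAt_growthProfile {t : ℝ} (ht : 0 ≤ t) :
    HasDerivAt growthProfile (growthProfile' t) t := by
  have h2t : 2 + t ≠ 0 := by linarith
  have hinv : HasDerivAt (fun s : ℝ => 2 / (2 + s)) (-(2 / (2 + t) ^ 2)) t := by
    refine ((hasDerivAt_const t 2).div ((hasDerivAt_id t).const_add 2) h2t).congr_deriv ?_
    simp only [id_eq]
    ring
  refine (((Real.hasDerivAt_exp t).mul (hinv.const_add 1)).sub
    ((hasDerivAt_exp_neg t).const_mul 2)).congr_deriv ?_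
  rw [growthProfile']
  ring

theorem hasDerivAt_growthProfile' {t : ℝ} (ht : 0 ≤ t) :
    HasDerivAt growthProfile' (growthProfile'' t) t := by
  have h2t : (2 + t) ≠ 0 := by linarith
  have hfrac : HasDerivAt (fun s : ℝ => 1 + 2 / (2 + s) - 2 / (2 + s) ^ 2)
      (-(2 / (2 + t) ^ 2) + 4 / (2 + t) ^ 3) t := by
    have hadd := (hasDerivAt_id t).const_add 2
    refine ((((hasDerivAt_const t 2).div hadd h2t).const_add 1).sub
      ((hasDerivAt_const t 2).div (hadd.pow 2) (pow_ne_zero 2 h2t))).congr_deriv ?_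
    simp only [id_eq, Pi.pow_apply]
    field_simp
    ring
  refine (((Real.hasDerivAt_exp t).mul hfrac).add
    ((hasDerivAt_exp_neg t).const_mul 2)).congr_deriv ?_
  rw [growthProfile'']
  ring

theorem growthProfile_zero : growthProfile 0 = 0 := by
  norm_num [growthProfile]

theorem growthProfile_nonneg {t : ℝ} (ht : 0 ≤ t) : 0 ≤ growthProfile t := by
  have hmono := monotoneOn_Icc_of_hasDerivWithinAt (a := 0) (c := t)
    (fun s hs => (hasDerivAt_growthProfile hs.1).hasDerivWithinAt) (fun s hs => by
      have hs0 : 0 < s := hs.1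
      have : 2 / (2 + s) ^ 2 ≤ 1 := by rw [div_le_one (by positivity)]; nlinarith
      have : 0 ≤ 1 + 2 / (2 + s) - 2 / (2 + s) ^ 2 := by
        have : 0 ≤ 2 / (2 + s) := by positivity
        linarith
      rw [growthProfile']
      positivity)
  exact growthProfile_zero ▸ hmono (left_mem_Icc.2 ht) (right_mem_Icc.2 ht) ht

theorem half_exp_le_growthProfile {t : ℝ} (ht : 1 ≤ t) : Real.exp t / 2 ≤ growthProfile t := by
  have hfrac : 0 ≤ Real.exp t * (2 / (2 + t)) := by positivity
  have hexp : 2 ≤ Real.exp t := by linarith [Real.add_one_le_exp t]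
  have hinv : Real.exp t * Real.exp (-t) = 1 := by rw [← Real.exp_add]; simp
  have : 4 * Real.exp (-t) ≤ Real.exp t := by nlinarith [Real.exp_pos (-t)]
  rw [growthProfile]
  linarith

theorem growthProfile''_le {κ : ℝ} (hκ : -(1 / 4) ≤ κ) {t : ℝ} (ht : 0 ≤ t) :
    growthProfile'' t ≤ (1 + κ / (1 + t) ^ 2) * growthProfile t := by
  have hw := growthProfile_nonneg ht
  have hpoly : 4 / (2 + t) ^ 3 - 4 / (2 + t) ^ 2
      ≤ -(1 / 4) / (1 + t) ^ 2 * (1 + 2 / (2 + t)) := by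
    have hdiff : -(1 / 4) / (1 + t) ^ 2 * (1 + 2 / (2 + t)) - (4 / (2 + t) ^ 3 - 4 / (2 + t) ^ 2)
        = (16 * (1 + t) ^ 3 - (4 + t) * (2 + t) ^ 2) / (4 * (1 + t) ^ 2 * (2 + t) ^ 3) := by
      field_simp
      ring
    have hnum : 0 ≤ 16 * (1 + t) ^ 3 - (4 + t) * (2 + t) ^ 2 := by
      nlinarith [pow_nonneg ht 2, pow_nonneg ht 3]
    rw [← sub_nonneg, hdiff]
    positivity
  have hle : growthProfile t ≤ Real.exp t * (1 + 2 / (2 + t)) :=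
    sub_le_self _ (by positivity)
  calc growthProfile'' t
      = growthProfile t + Real.exp t * (4 / (2 + t) ^ 3 - 4 / (2 + t) ^ 2) := by
        rw [growthProfile'', growthProfile]; ring
    _ ≤ growthProfile t
        + Real.exp t * (-(1 / 4) / (1 + t) ^ 2 * (1 + 2 / (2 + t))) := by gcongr
    _ = growthProfile t - 1 / 4 / (1 + t) ^ 2 * (Real.exp t * (1 + 2 / (2 + t))) := by ring
    _ ≤ growthProfile t - 1 / 4 / (1 + t) ^ 2 * growthProfile t := by gcongr
    _ = (1 + -(1 / 4) / (1 + t) ^ 2) * growthProfile t := by ring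
    _ ≤ (1 + κ / (1 + t) ^ 2) * growthProfile t := by gcongr

theorem IsSupersolution.exp_le (h : IsSupersolution μ q τ H H H₁) (hq : 0 < q) {t : ℝ}
    (ht1 : 1 ≤ t) (ht : t ≤ τ) : q / 8 * (1 + t) ^ (-(μ / 2)) * Real.exp t ≤ H t := by
  set a := -(μ / 2) with ha
  have hpos {s : ℝ} (hs : s ∈ Icc 0 τ) : 0 < 1 + s := by linarith [hs.1]
  have hw {s : ℝ} (hs : s ∈ Icc 0 τ) := hasDerivAt_growthProfile hs.1
  have hw' {s : ℝ} (hs : s ∈ Icc 0 τ) := hasDerivAt_growthProfile' hs.1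
  have hle := h.subsolution_le
    (fun s hs => (hasDerivAt_one_add_rpow_mul a (hpos hs) (hw hs)).const_mul (q / 4))
    (fun s hs => (hasDerivAt_liouville a (hpos hs) (hw hs) (hw' hs)).const_mul (q / 4))
    (fun s hs => by
      have h1s := hpos hs
      have hκ : -(1 / 4) ≤ a ^ 2 + a := by nlinarith [sq_nonneg (a + 1 / 2)]
      have hsub := mul_le_mul_of_nonneg_left (growthProfile''_le hκ hs.1)
        (show 0 ≤ q / 4 * (1 + s) ^ a by positivity)
      have hμa : μ = -(2 * a) := by rw [ha]; ring
      rw [hμa]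
      refine le_trans (le_of_eq ?_) (sub_le_iff_le_add.2 (hsub.trans_eq (c :=
        q / 4 * ((1 + s) ^ a * growthProfile s)
          + q / 4 * (1 + s) ^ a * ((a ^ 2 + a) / (1 + s) ^ 2 * growthProfile s)) (by ring)))
      field_simp
      ring)
    (by rw [growthProfile_zero, mul_zero, mul_zero])
    (by norm_num [growthProfile, growthProfile']; linarith)
    (t := t) ⟨by linarith, ht⟩
  refine le_trans ?_ hle
  have := mul_le_mul_of_nonneg_left (half_exp_le_growthProfile ht1)
    (show 0 ≤ q / 4 * (1 + t) ^ a by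
      have := hpos (s := t) ⟨by linarith, ht⟩
      positivity)
  linarith

end ExponentialGrowth

section SelfForcing

variable {F N : ℝ → ℝ} {σ B C L p : ℝ}

theorem selfForcing_step (hp : 1 < p) (hσ : 0 < σ) (hC : 0 < C) (hB : 0 < B) (hL : 0 < L)
    (hN : ∀ t ∈ Icc σ (2 * σ), B * F t ^ p ≤ N t)
    (hforce : ∀ a t ν : ℝ, σ ≤ a → a ≤ t → t ≤ 2 * σ → 0 ≤ ν → (∀ s ∈ Icc a t, ν ≤ N s) →
      ν * (t - a) ^ 2 ≤ C * F t)
    (hlarge : C * (4 * 4 ^ (1 / (p - 1))) ≤ B * σ ^ 2 * L ^ (p - 1)) (k : ℕ)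
    (ih : ∀ t ∈ Icc (2 * σ - σ / 2 ^ k) (2 * σ), L * (4 ^ (1 / (p - 1))) ^ k ≤ F t) :
    ∀ t ∈ Icc (2 * σ - σ / 2 ^ (k + 1)) (2 * σ), L * (4 ^ (1 / (p - 1))) ^ (k + 1) ≤ F t := by
  intro t ht
  set D : ℝ := 4 ^ (1 / (p - 1)) with hD
  have hD0 : 0 < D := by positivity
  set m := L * D ^ k with hm
  have hm0 : 0 < m := by positivity
  have hpow : m ^ p = m * L ^ (p - 1) * (2 ^ k) ^ 2 := by
    have hDk : (D ^ k) ^ (p - 1) = (2 ^ k) ^ 2 := by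
      rw [← Real.rpow_pow_comm hD0.le, hD, ← Real.rpow_mul (by norm_num),
        one_div_mul_cancel (sub_pos.2 hp).ne', Real.rpow_one, ← pow_mul, mul_comm, pow_mul]
      norm_num
    calc m ^ p = m * m ^ (p - 1) := by
          rw [← Real.rpow_one_add' hm0.le (by linarith)]; ring_nf
      _ = _ := by rw [hm, Real.mul_rpow hL.le (by positivity), hDk]; ring
  have hhalf : σ / 2 ^ (k + 1) = σ / 2 ^ k / 2 := by rw [pow_succ]; field_simp
  have hσk : 0 < σ / 2 ^ k := by positivity
  have hσk' : σ / 2 ^ k ≤ σ := div_le_self hσ.le (one_le_pow₀ (by norm_num))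
  have ht1 : 2 * σ - σ / 2 ^ k / 2 ≤ t := hhalf ▸ ht.1
  have hF := hforce (2 * σ - σ / 2 ^ k) t (B * m ^ p) (by linarith) (by linarith) ht.2
    (by positivity) fun s hs => by
      refine le_trans ?_ (hN s ⟨by linarith [hs.1], hs.2.trans ht.2⟩)
      have := ih s ⟨hs.1, hs.2.trans ht.2⟩
      gcongr
  refine le_of_mul_le_mul_left ?_ hC
  calc C * (L * D ^ (k + 1)) = m / 4 * (C * (4 * D)) := by rw [hm]; ring
    _ ≤ m / 4 * (B * σ ^ 2 * L ^ (p - 1)) := by gcongr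
    _ = B * m ^ p * (σ / 2 ^ k / 2) ^ 2 := by rw [hpow]; field_simp; norm_num
    _ ≤ B * m ^ p * (t - (2 * σ - σ / 2 ^ k)) ^ 2 := by gcongr; linarith
    _ ≤ C * F t := hF

-- If the bound failed, iterating the self-forcing would give `F ≥ L D^k` on the `k`-th of the
-- intervals `[2σ - σ/2^k, 2σ]` with `D = 4^(1/(p-1)) > 1`, so that `F(2σ)` would be infinite.
theorem selfForcing_lt (hp : 1 < p) (hσ : 0 < σ) (hC : 0 < C) (hB : 0 < B) (hL : 0 < L)
    (hF : ∀ t ∈ Icc σ (2 * σ), L ≤ F t) (hN : ∀ t ∈ Icc σ (2 * σ), B * F t ^ p ≤ N t)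
    (hforce : ∀ a t ν : ℝ, σ ≤ a → a ≤ t → t ≤ 2 * σ → 0 ≤ ν → (∀ s ∈ Icc a t, ν ≤ N s) →
      ν * (t - a) ^ 2 ≤ C * F t) :
    B * σ ^ 2 * L ^ (p - 1) < C * (4 * 4 ^ (1 / (p - 1))) := by
  by_contra! hlarge
  have hgrowth (k : ℕ) :
      ∀ t ∈ Icc (2 * σ - σ / 2 ^ k) (2 * σ), L * (4 ^ (1 / (p - 1))) ^ k ≤ F t := by
    induction k with
    | zero => simpa [two_mul] using fun t h1 h2 => hF t ⟨h1, by linarith⟩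
    | succ k ih => exact selfForcing_step hp hσ hC hB hL hN hforce hlarge k ih
  have hD : (1 : ℝ) < 4 ^ (1 / (p - 1)) :=
    Real.one_lt_rpow (by norm_num) (one_div_pos.2 (sub_pos.2 hp))
  obtain ⟨k, hk⟩ := pow_unbounded_of_one_lt (F (2 * σ) / L) hD
  rw [div_lt_iff₀' hL] at hk
  exact hk.not_ge (hgrowth k (2 * σ) ⟨sub_le_self _ (by positivity), le_rfl⟩)

end SelfForcing

/-! ### Radial test functions -/

section TestFunctions

variable {n : ℕ}

theorem gradient_apply (Ψ : Space n → ℝ) (x : Space n) (i : Fin n) :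
    gradient Ψ x i = fderiv ℝ Ψ x (EuclideanSpace.single i 1) := by
  simp [← inner_gradient_left, EuclideanSpace.inner_single_right]

theorem contDiff_gradient_apply {Ψ : Space n → ℝ} (hΨ : ContDiff ℝ ∞ Ψ) (i : Fin n) :
    ContDiff ℝ ∞ fun x => gradient Ψ x i := by
  simp_rw [gradient_apply]
  exact (hΨ.fderiv_right (m := ∞) (by simp)).clm_apply contDiff_const

theorem continuous_gradient {Ψ : Space n → ℝ} (hΨ : ContDiff ℝ ∞ Ψ) :
    Continuous (gradient Ψ) :=
  (LinearIsometryEquiv.continuous _).comp (hΨ.continuous_fderiv (by simp))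

theorem hasCompactSupport_gradient {Ψ : Space n → ℝ} (hΨ : HasCompactSupport Ψ) :
    HasCompactSupport (gradient Ψ) :=
  (hΨ.fderiv ℝ).comp_left (g := (InnerProductSpace.toDual ℝ (Space n)).symm) (by simp)

theorem hasCompactSupport_gradient_apply {Ψ : Space n → ℝ} (hΨ : HasCompactSupport Ψ)
    (i : Fin n) : HasCompactSupport fun x => gradient Ψ x i :=
  (hasCompactSupport_gradient hΨ).comp_left (g := fun v : Space n => v i) rfl

theorem laplacian_eq_sum_gradient {Ψ : Space n → ℝ} (hΨ : ContDiff ℝ ∞ Ψ) (x : Space n) :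
    Laplacian.laplacian Ψ x = ∑ i, gradient (fun y => gradient Ψ y i) x i := by
  rw [InnerProductSpace.laplacian_eq_iteratedFDeriv_orthonormalBasis Ψ
    (EuclideanSpace.basisFun (Fin n) ℝ)]
  refine Finset.sum_congr rfl fun i _ => ?_
  have hdiff : DifferentiableAt ℝ (fderiv ℝ Ψ) x :=
    (hΨ.fderiv_right (m := ∞) (by simp)).differentiable (by simp) x
  simp only [gradient_apply, iteratedFDeriv_two_apply]
  rw [fderiv_clm_apply hdiff (differentiableAt_const _)]
  simp

/-- The radial solution `φ` of `Δ φ = e φ` with `φ 0 = 1`. -/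
noncomputable def radialProfile (n : ℕ) (e : ℝ) (x : Space n) : ℝ := besselSeries n (e * ‖x‖ ^ 2)

theorem contDiff_radialProfile (hn : 0 < n) (e : ℝ) : ContDiff ℝ ∞ (radialProfile n e) :=
  (contDiff_besselSeries (Nat.cast_pos.2 hn)).comp (contDiff_const.mul (contDiff_norm_sq ℝ))

theorem one_le_radialProfile (hn : 0 < n) {e : ℝ} (he : 0 ≤ e) (x : Space n) :
    1 ≤ radialProfile n e x :=
  one_le_besselSeries (Nat.cast_pos.2 hn) (by positivity)

theorem radialProfile_zero (x : Space n) : radialProfile n 0 x = 1 := by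
  simp [radialProfile, besselSeries_zero]

theorem hasFDerivAt_besselSeries_norm_sq {ν : ℝ} (hν : 0 < ν) (e : ℝ) (x : Space n) :
    HasFDerivAt (fun y : Space n => besselSeries ν (e * ‖y‖ ^ 2))
      ((besselSeries (ν + 2) (e * ‖x‖ ^ 2) / ν * e) • innerSL ℝ x) x := by
  have hinner := ((hasFDerivAt_id x).norm_sq).const_mul e
  refine ((hasDerivAt_besselSeries hν _).comp_hasFDerivAt x hinner).congr_fderiv ?_
  rw [ContinuousLinearMap.comp_id, ← Nat.cast_smul_eq_nsmul ℝ, smul_smul, smul_smul]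
  congr 1
  push_cast [id]
  field_simp

theorem gradient_radialProfile_apply (hn : 0 < n) (e : ℝ) (x : Space n) (i : Fin n) :
    gradient (radialProfile n e) x i = besselSeries (n + 2) (e * ‖x‖ ^ 2) * (e / n * x i) := by
  have hderiv : HasFDerivAt (radialProfile n e) _ x :=
    hasFDerivAt_besselSeries_norm_sq (Nat.cast_pos.2 hn) e x
  rw [gradient_apply, hderiv.fderiv]
  simp only [smul_apply, innerSL_apply_apply,
    EuclideanSpace.inner_single_right, smul_eq_mul, one_mul, conj_trivial]
  ring

theorem gradient_gradient_radialProfile_apply (hn : 0 < n) (e : ℝ) (x : Space n) (i : Fin n) :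
    gradient (fun y => gradient (radialProfile n e) y i) x i
      = e ^ 2 * besselSeries (n + 2 + 2) (e * ‖x‖ ^ 2) / (n * (n + 2)) * x i ^ 2
        + e * besselSeries (n + 2) (e * ‖x‖ ^ 2) / n := by
  simp_rw [gradient_apply _ x, gradient_radialProfile_apply hn]
  have hcoord : HasFDerivAt (fun y : Space n => e / n * y i)
      ((e / n) • (EuclideanSpace.proj i : Space n →L[ℝ] ℝ)) x :=
    (EuclideanSpace.proj (𝕜 := ℝ) i : Space n →L[ℝ] ℝ).hasFDerivAt.const_mul _
  have proj_single : (EuclideanSpace.proj i : Space n →L[ℝ] ℝ) (EuclideanSpace.single i 1) = 1 := by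
    simp
  have hbessel := hasFDerivAt_besselSeries_norm_sq (ν := n + 2) (by positivity) e x
  rw [(hbessel.fun_mul hcoord).fderiv]
  simp only [add_apply, smul_apply, innerSL_apply_apply,
    EuclideanSpace.inner_single_right, proj_single, smul_eq_mul, one_mul, mul_one, conj_trivial]
  field_simp
  ring

theorem laplacian_radialProfile (hn : 0 < n) (e : ℝ) (x : Space n) :
    Laplacian.laplacian (radialProfile n e) x = e * radialProfile n e x := by
  rw [laplacian_eq_sum_gradient (contDiff_radialProfile hn e), radialProfile,
    ← besselSeries_ode (Nat.cast_pos.2 hn)]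
  simp_rw [gradient_gradient_radialProfile_apply hn]
  rw [Finset.sum_add_distrib, ← Finset.mul_sum, ← EuclideanSpace.real_norm_sq_eq]
  simp only [Finset.sum_const, Finset.card_univ, Fintype.card_fin, nsmul_eq_mul]
  field_simp

/-- `Ψ` is a nonnegative test function which, on the ball of radius `ρ`, is at least one and solves
`Δ Ψ = e Ψ`. -/
structure IsLocalEigenfunction (e ρ : ℝ) (Ψ : Space n → ℝ) : Prop where
  contDiff : ContDiff ℝ ∞ Ψ
  hasCompactSupport : HasCompactSupport Ψ
  nonneg : ∀ x, 0 ≤ Ψ x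
  one_le : ∀ x, ‖x‖ < ρ → 1 ≤ Ψ x
  laplacian_eq : ∀ x, ‖x‖ < ρ → Laplacian.laplacian Ψ x = e * Ψ x

theorem IsLocalEigenfunction.memLp {e ρ : ℝ} {Ψ : Space n → ℝ} (h : IsLocalEigenfunction e ρ Ψ)
    (q : ℝ≥0∞) : MemLp Ψ q volume :=
  h.contDiff.continuous.memLp_of_hasCompactSupport h.hasCompactSupport

theorem exists_cutoff_radialProfile (hn : 0 < n) {e : ℝ} (he : 0 ≤ e) {ρ : ℝ} (hρ : 0 < ρ) :
    ∃ Ψ : Space n → ℝ, IsLocalEigenfunction e ρ Ψ ∧ ∀ x, ‖x‖ < ρ → Ψ x = radialProfile n e x := by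
  let χ : ContDiffBump (0 : Space n) := ⟨ρ, ρ + 1, hρ, by linarith⟩
  have eq_profile : ∀ x : Space n, ‖x‖ < ρ → χ x * radialProfile n e x = radialProfile n e x := by
    intro x hx
    rw [χ.one_of_mem_closedBall (by simpa [χ] using hx.le), one_mul]
  refine ⟨fun x => χ x * radialProfile n e x, ⟨χ.contDiff.mul (contDiff_radialProfile hn e),
    χ.hasCompactSupport.mul_right, fun x => mul_nonneg χ.nonneg
      (zero_le_one.trans (one_le_radialProfile hn he x)),
    fun x hx => (one_le_radialProfile hn he x).trans_eq (eq_profile x hx).symm, fun x hx => ?_⟩,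
    eq_profile⟩
  have eventuallyEq : (fun x => χ x * radialProfile n e x) =ᶠ[𝓝 x] radialProfile n e := by
    filter_upwards [(isOpen_lt continuous_norm continuous_const).mem_nhds hx] with y hy
    exact eq_profile y hy
  rw [(InnerProductSpace.laplacian_congr_nhds eventuallyEq).eq_of_nhds,
    laplacian_radialProfile hn]
  exact congrArg (e * ·) (eq_profile x hx).symm

section WeakGradient

variable {w : Space n → ℝ} {G V : Space n → Space n}

theorem memLp_apply {q : ℝ≥0∞} (hV : MemLp V q volume) (i : Fin n) :
    MemLp (fun x => V x i) q volume :=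
  (EuclideanSpace.proj (𝕜 := ℝ) i : Space n →L[ℝ] ℝ).comp_memLp' hV

theorem integrable_inner_of_memLp (hG : MemLp G 2 volume) (hV : MemLp V 2 volume) :
    Integrable fun x => inner ℝ (G x) (V x) := by
  refine (L2.integrable_inner (𝕜 := ℝ) hG.toLp hV.toLp).congr ?_
  filter_upwards [hG.coeFn_toLp, hV.coeFn_toLp] with x hGx hVx
  rw [hGx, hVx]

theorem IsWeakGradient.integral_mul_gradient_apply (h : IsWeakGradient w G)
    (hw : MemLp w 2 volume) (hG : MemLp G 2 volume) {ψ : Space n → ℝ} (hψ : ContDiff ℝ ∞ ψ)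
    (hψc : HasCompactSupport ψ) (i : Fin n) :
    ∫ x, w x * gradient ψ x i = -∫ x, ψ x * G x i := by
  have gradient_memLp : MemLp (gradient ψ) 2 (volume : Measure (Space n)) :=
    (continuous_gradient hψ).memLp_of_hasCompactSupport (hasCompactSupport_gradient hψc)
  have ψ_memLp : MemLp ψ 2 (volume : Measure (Space n)) :=
    hψ.continuous.memLp_of_hasCompactSupport hψc
  have integrable_left : Integrable (fun x => w x • gradient ψ x) :=
    memLp_one_iff_integrable.1 (gradient_memLp.smul hw)
  have integrable_right : Integrable (fun x => ψ x • G x) :=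
    memLp_one_iff_integrable.1 (hG.smul ψ_memLp)
  have hi := congrArg (EuclideanSpace.proj (𝕜 := ℝ) i : Space n →L[ℝ] ℝ) (h ψ hψ hψc)
  rw [map_neg, ← ContinuousLinearMap.integral_comp_comm _ integrable_left,
    ← ContinuousLinearMap.integral_comp_comm _ integrable_right] at hi
  simpa using hi

theorem IsWeakGradient.integral_inner_gradient (h : IsWeakGradient w G) (hw : MemLp w 2 volume)
    (hG : MemLp G 2 volume) {Ψ : Space n → ℝ} (hΨ : ContDiff ℝ ∞ Ψ)
    (hΨc : HasCompactSupport Ψ) :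
    ∫ x, inner ℝ (G x) (gradient Ψ x) = -∫ x, w x * Laplacian.laplacian Ψ x := by
  have hΨi := contDiff_gradient_apply hΨ
  have hΨci := hasCompactSupport_gradient_apply hΨc
  have memLp_first : ∀ i, MemLp (fun x => gradient Ψ x i) 2 (volume : Measure (Space n)) :=
    fun i => (hΨi i).continuous.memLp_of_hasCompactSupport (hΨci i)
  have memLp_second : ∀ i, MemLp (fun x => gradient (fun y => gradient Ψ y i) x i) 2
      (volume : Measure (Space n)) := fun i =>
    (contDiff_gradient_apply (hΨi i) i).continuous.memLp_of_hasCompactSupport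
      (hasCompactSupport_gradient_apply (hΨci i) i)
  simp_rw [laplacian_eq_sum_gradient hΨ, Finset.mul_sum, PiLp.inner_apply, RCLike.inner_apply,
    conj_trivial]
  rw [integral_finsetSum, integral_finsetSum, ← Finset.sum_neg_distrib]
  rotate_left
  · exact fun i _ => hw.integrable_mul (memLp_second i)
  · exact fun i _ => (memLp_first i).integrable_mul (memLp_apply hG i)
  refine Finset.sum_congr rfl fun i _ => ?_
  rw [h.integral_mul_gradient_apply hw hG (hΨi i) (hΨci i), neg_neg]

end WeakGradient

theorem exists_cutoff_time {θ : ℝ → ℝ} (hθ : ContDiffOn ℝ ∞ θ (Ioi (-1))) {t T : ℝ} (ht0 : 0 ≤ t)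
    (htT : t < T) : ∃ ζ : ℝ → ℝ, ContDiff ℝ ∞ ζ ∧ HasCompactSupport ζ ∧ tsupport ζ ⊆ Iio T ∧
      ∀ s ∈ Icc 0 t, ζ =ᶠ[𝓝 s] θ := by
  obtain ⟨δ, hδ0, hδ⟩ : ∃ δ > 0, δ < min (1 / 2) ((T - t) / 2) :=
    exists_between (lt_min one_half_pos (by linarith))
  obtain ⟨hδ1, hδT⟩ := lt_min_iff.1 hδ
  let η : ContDiffBump (t / 2) := ⟨t / 2 + δ, t / 2 + 2 * δ, by positivity, by linarith⟩
  have tsupport_subset : tsupport η ⊆ Ioo (-1) T := by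
    rw [η.tsupport_eq, Real.closedBall_eq_Icc]
    exact Icc_subset_Ioo (by simp only [η]; linarith) (by simp only [η]; linarith)
  refine ⟨fun s => η s * θ s, ?_, η.hasCompactSupport.mul_right, ?_, fun s hs => ?_⟩
  · refine contDiff_iff_contDiffAt.2 fun s => ?_
    by_cases hs : s ∈ tsupport η
    · exact η.contDiff.contDiffAt.mul (hθ.contDiffAt (Ioi_mem_nhds (tsupport_subset hs).1))
    · refine (contDiffAt_const (c := (0 : ℝ))).congr_of_eventuallyEq ?_
      filter_upwards [notMem_tsupport_iff_eventuallyEq.1 hs] with r hr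
      rw [hr, Pi.zero_apply, zero_mul]
  · exact (tsupport_mul_subset_left (f := η) (g := θ)).trans fun s hs => (tsupport_subset hs).2
  · have hball : Metric.ball (t / 2) (t / 2 + δ) ∈ 𝓝 s := Metric.isOpen_ball.mem_nhds <| by
      rw [Real.ball_eq_Ioo]
      exact ⟨by linarith [hs.1], by linarith [hs.2]⟩
    filter_upwards [hball] with r hr
    rw [η.one_of_mem_closedBall (Metric.ball_subset_closedBall hr), one_mul]

end TestFunctions

/-! ### Moments of energy solutions -/

section WeakForm

variable {n : ℕ} {μ p ε T R e ρ τ : ℝ} {f g Ψ : Space n → ℝ}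
  {u ut : ℝ → Lp ℝ 2 (volume : Measure (Space n))}
  {Du : ℝ → Lp (Space n) 2 (volume : Measure (Space n))}

/-- The initial flux `∫ ([μ-1]₊ f + g)` over the ball of radius `R`. -/
noncomputable def initialFlux (μ R : ℝ) (f g : Space n → ℝ) : ℝ :=
  ∫ x in Metric.closedBall 0 R, ((μ - 1)⁺ * f x + g x)

/-- Initial data in `L²` with the signs required for blow-up; the positivity of the initial flux
is localised to the ball of radius `R`, so that it can be compared with any test function that is
at least one there. -/
structure IsBlowupData (μ R : ℝ) (f g : Space n → ℝ) : Prop where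
  radius_nonneg : 0 ≤ R
  memLp_init : MemLp f 2 volume
  memLp_velocity : MemLp g 2 volume
  init_nonneg : ∀ᵐ x, 0 ≤ f x
  flux_nonneg : ∀ᵐ x, 0 ≤ (μ - 1)⁺ * f x + g x
  initialFlux_pos : 0 < initialFlux μ R f g

/-- `u` satisfies the weak form of the equation, as in `IsEnergySolution`, with time derivative `ut`
and spatial gradient `Du`. -/
structure IsWeakSolution (μ p ε : ℝ) (g : Space n → ℝ) (T : ℝ)
    (u ut : ℝ → Lp ℝ 2 (volume : Measure (Space n)))
    (Du : ℝ → Lp (Space n) 2 (volume : Measure (Space n))) : Prop where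
  isWeakGradient : ∀ t ∈ Ico 0 T, IsWeakGradient (u t) (Du t)
  hasDerivWithinAt : ∀ t ∈ Ico 0 T, HasDerivWithinAt u (ut t) (Ico 0 T) t
  continuousOn_deriv : ContinuousOn ut (Ico 0 T)
  deriv_zero : ut 0 =ᵐ[volume] fun x => ε * g x
  weak_identity : ∀ φ : Space n × ℝ → ℝ, ContDiff ℝ ∞ φ → HasCompactSupport φ →
    tsupport φ ⊆ {z | z.2 < T} → ∀ t ∈ Ico 0 T,
      (∫ x, ut t x * φ (x, t)) - (∫ x, ε * g x * φ (x, 0))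
        + (∫ s in 0..t, ∫ x, (-(ut s x * deriv (fun τ => φ (x, τ)) s)
            + inner ℝ (Du s x) (gradient (fun y => φ (y, s)) x)))
        + (∫ s in 0..t, ∫ x, μ / (1 + s) * ut s x * φ (x, s))
      = ∫ s in 0..t, ∫ x, |u s x| ^ p * φ (x, s)

theorem IsEnergySolution.exists_isWeakSolution (hu : IsEnergySolution μ p ε f g T u) :
    ∃ (ut : ℝ → Lp ℝ 2 (volume : Measure (Space n)))
      (Du : ℝ → Lp (Space n) 2 (volume : Measure (Space n))),
      IsWeakSolution μ p ε g T u ut Du := by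
  obtain ⟨ut, Du, -, hgrad, -, hderiv, hcont, hzero, hweak⟩ := hu.weak_form
  exact ⟨ut, Du, hgrad, hderiv, hcont, hzero, hweak⟩

/-- The moment `∫ u(t) Ψ` of a curve `u` in `L²`. -/
noncomputable def moment (Ψ : Space n → ℝ) (u : ℝ → Lp ℝ 2 (volume : Measure (Space n)))
    (t : ℝ) : ℝ :=
  ∫ x, u t x * Ψ x

/-- The moment `∫ |u(t)|^p Ψ` of the nonlinearity. -/
noncomputable def powerMoment (p : ℝ) (Ψ : Space n → ℝ)
    (u : ℝ → Lp ℝ 2 (volume : Measure (Space n))) (t : ℝ) : ℝ :=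
  ∫ x, |u t x| ^ p * Ψ x

theorem powerMoment_nonneg (hΨ : ∀ x, 0 ≤ Ψ x) (t : ℝ) : 0 ≤ powerMoment p Ψ u t :=
  integral_nonneg fun x => mul_nonneg (Real.rpow_nonneg (abs_nonneg _) _) (hΨ x)

theorem moment_eq_innerSL (hΨ : MemLp Ψ 2 volume) :
    moment Ψ u = fun t => innerSL ℝ hΨ.toLp (u t) := by
  ext t
  rw [moment, innerSL_apply_apply, L2.inner_def]
  refine integral_congr_ae ?_
  filter_upwards [hΨ.coeFn_toLp] with x hx
  rw [hx, RCLike.inner_apply, conj_trivial]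

theorem moment_eq_of_ae_eq {t : ℝ} {w : Space n → ℝ} (h : u t =ᵐ[volume] fun x => ε * w x) :
    moment Ψ u t = ε * ∫ x, w x * Ψ x := by
  rw [moment, ← integral_const_mul]
  refine integral_congr_ae ?_
  filter_upwards [h] with x hx
  rw [hx, mul_assoc]

theorem IsWeakGradient.integral_inner_gradient_eigenfunction {w : Space n → ℝ}
    {G : Space n → Space n} (h : IsWeakGradient w G) (hw : MemLp w 2 volume)
    (hG : MemLp G 2 volume) (hΨ : IsLocalEigenfunction e ρ Ψ)
    (hsupp : ∀ᵐ x, ρ ≤ ‖x‖ → w x = 0) :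
    ∫ x, inner ℝ (G x) (gradient Ψ x) = -(e * ∫ x, w x * Ψ x) := by
  rw [h.integral_inner_gradient hw hG hΨ.contDiff hΨ.hasCompactSupport, ← integral_const_mul]
  congr 1
  refine integral_congr_ae ?_
  filter_upwards [hsupp] with x hx
  rcases lt_or_ge ‖x‖ ρ with hxρ | hxρ
  · rw [hΨ.laplacian_eq x hxρ, mul_left_comm]
  · rw [hx hxρ, zero_mul, zero_mul, mul_zero]

theorem integral_energy_separated (hΨ : ContDiff ℝ ∞ Ψ) (hΨc : HasCompactSupport Ψ)
    (v : Lp ℝ 2 (volume : Measure (Space n))) (G : Lp (Space n) 2 (volume : Measure (Space n)))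
    (ζ : ℝ → ℝ) (s : ℝ) :
    ∫ x, (-(v x * deriv (fun τ => Ψ x * ζ τ) s) + inner ℝ (G x) (gradient (fun y => Ψ y * ζ s) x))
      = -(deriv ζ s * ∫ x, v x * Ψ x) + ζ s * ∫ x, inner ℝ (G x) (gradient Ψ x) := by
  have hgrad : ∀ x, gradient (fun y => Ψ y * ζ s) x = ζ s • gradient Ψ x := fun x => by
    have hdiff : DifferentiableAt ℝ Ψ x := hΨ.differentiable (by simp) x
    rw [gradient, fderiv_mul_const hdiff, map_smulₛₗ, conj_trivial, gradient]
  have hΨ_memLp : MemLp Ψ 2 volume := hΨ.continuous.memLp_of_hasCompactSupport hΨc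
  have integrable_time : Integrable fun x => deriv ζ s * (v x * Ψ x) :=
    ((Lp.memLp v).integrable_mul hΨ_memLp).const_mul _
  have integrable_space : Integrable fun x => ζ s * inner ℝ (G x) (gradient Ψ x) :=
    (integrable_inner_of_memLp (Lp.memLp G) ((continuous_gradient hΨ).memLp_of_hasCompactSupport
      (hasCompactSupport_gradient hΨc))).const_mul _
  rw [← integral_const_mul, ← integral_const_mul, ← integral_neg]
  refine Eq.trans ?_ (integral_add integrable_time.neg integrable_space)
  refine integral_congr_ae (Eventually.of_forall fun x => ?_)
  simp only [hgrad, deriv_const_mul_field, inner_smul_right]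
  ring

/- The weight `(1 + s) ^ min μ 1` turns the damping into an exact derivative: what remains of it is
`[μ-1]₊ H'`. -/
theorem integral_damping {H H₁ : ℝ → ℝ} {t : ℝ} (e : ℝ) (ht : 0 ≤ t)
    (hH : ContinuousOn H (Icc 0 t)) (hH₁ : ContinuousOn H₁ (Icc 0 t))
    (hderiv : ∀ s ∈ Ioo 0 t, HasDerivAt H (H₁ s) s) :
    (∫ s in 0..t, (-(min μ 1 * (1 + s) ^ (min μ 1 - 1) * H₁ s)
        - e * ((1 + s) ^ min μ 1 * H s)))
      + (∫ s in 0..t, μ / (1 + s) * ((1 + s) ^ min μ 1 * H₁ s))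
      = (μ - 1)⁺ * (H t - H 0) - e * ∫ s in 0..t, (1 + s) ^ min μ 1 * H s := by
  have ftc : ∫ s in 0..t, H₁ s = H t - H 0 :=
    intervalIntegral.integral_eq_sub_of_hasDerivAt_of_le ht hH hderiv
      (hH₁.intervalIntegrable_of_Icc ht)
  have hpow (a : ℝ) := continuousOn_one_add_rpow a t
  have hdiv : ContinuousOn (fun s : ℝ => μ / (1 + s)) (Icc 0 t) :=
    continuousOn_const.div (continuousOn_const.add continuousOn_id)
      fun s hs => (by linarith [hs.1] : 0 < 1 + s).ne'
  have hweight : ContinuousOn (fun s => e * ((1 + s) ^ min μ 1 * H s)) (Icc 0 t) :=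
    ((hpow _).mul hH).const_mul e
  have integrable_derivative : IntervalIntegrable (fun s =>
      -(min μ 1 * (1 + s) ^ (min μ 1 - 1) * H₁ s) - e * ((1 + s) ^ min μ 1 * H s)) volume 0 t :=
    ((((hpow _).const_mul _).mul hH₁).neg.sub hweight).intervalIntegrable_of_Icc ht
  have integrable_damping : IntervalIntegrable (fun s =>
      μ / (1 + s) * ((1 + s) ^ min μ 1 * H₁ s)) volume 0 t :=
    (hdiv.mul ((hpow _).mul hH₁)).intervalIntegrable_of_Icc ht
  rw [← ftc, ← intervalIntegral.integral_const_mul, ← intervalIntegral.integral_const_mul,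
    ← intervalIntegral.integral_sub ((hH₁.const_mul _).intervalIntegrable_of_Icc ht)
      (hweight.intervalIntegrable_of_Icc ht),
    ← intervalIntegral.integral_add integrable_derivative integrable_damping]
  refine intervalIntegral.integral_congr fun s hs => ?_
  rw [uIcc_of_le ht] at hs
  have hs1 : 0 < 1 + s := by linarith [hs.1]
  have cancel : μ / (1 + s) * (1 + s) ^ min μ 1
      = min μ 1 * (1 + s) ^ (min μ 1 - 1) + (μ - 1)⁺ := by
    rw [← posPart_sub_one_mul_rpow μ (1 + s), ← add_mul, min_one_add_posPart_sub_one,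
      Real.rpow_sub_one hs1.ne', div_mul_eq_mul_div, mul_div_assoc]
  simp only [← mul_assoc (μ / (1 + s)), cancel]
  ring

namespace IsWeakSolution

theorem hasDerivWithinAt_moment (h : IsWeakSolution μ p ε g T u ut Du) (hΨ : MemLp Ψ 2 volume)
    {t : ℝ} (ht : t ∈ Ico 0 T) :
    HasDerivWithinAt (moment Ψ u) (moment Ψ ut t) (Ico 0 T) t := by
  rw [moment_eq_innerSL hΨ, moment_eq_innerSL hΨ]
  exact (innerSL ℝ hΨ.toLp).hasFDerivAt.comp_hasDerivWithinAt t (h.hasDerivWithinAt t ht)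

theorem continuousOn_moment (h : IsWeakSolution μ p ε g T u ut Du) (hΨ : MemLp Ψ 2 volume) :
    ContinuousOn (moment Ψ u) (Ico 0 T) :=
  fun _ ht => (h.hasDerivWithinAt_moment hΨ ht).continuousWithinAt

theorem continuousOn_moment_deriv (h : IsWeakSolution μ p ε g T u ut Du)
    (hΨ : MemLp Ψ 2 volume) : ContinuousOn (moment Ψ ut) (Ico 0 T) := by
  rw [moment_eq_innerSL hΨ]
  exact (innerSL ℝ hΨ.toLp).continuous.comp_continuousOn h.continuousOn_deriv

theorem separated_identity (h : IsWeakSolution μ p ε g T u ut Du) (hΨ : ContDiff ℝ ∞ Ψ)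
    (hΨc : HasCompactSupport Ψ) {ζ : ℝ → ℝ} (hζ : ContDiff ℝ ∞ ζ) (hζc : HasCompactSupport ζ)
    (hζT : tsupport ζ ⊆ Iio T) {t : ℝ} (ht : t ∈ Ico 0 T) :
    ζ t * moment Ψ ut t - ζ 0 * moment Ψ ut 0
      + (∫ s in 0..t, (-(deriv ζ s * moment Ψ ut s)
          + ζ s * ∫ x, inner ℝ (Du s x) (gradient Ψ x)))
      + (∫ s in 0..t, μ / (1 + s) * (ζ s * moment Ψ ut s))
      = ∫ s in 0..t, ζ s * powerMoment p Ψ u s := by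
  have hsupp : tsupport (fun z : Space n × ℝ => Ψ z.1 * ζ z.2) ⊆ tsupport Ψ ×ˢ tsupport ζ := by
    refine closure_minimal (fun z hz => ?_) ((isClosed_tsupport _).prod (isClosed_tsupport _))
    rw [Function.mem_support] at hz
    exact ⟨subset_tsupport _ (left_ne_zero_of_mul hz), subset_tsupport _ (right_ne_zero_of_mul hz)⟩
  have hweak := h.weak_identity (fun z => Ψ z.1 * ζ z.2)
    ((hΨ.comp contDiff_fst).mul (hζ.comp contDiff_snd))
    ((hΨc.isCompact.prod hζc.isCompact).of_isClosed_subset (isClosed_tsupport _) hsupp)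
    (fun z hz => hζT (hsupp hz).2) t ht
  have pull_const : ∀ (w : Space n → ℝ) (c : ℝ),
      ∫ x, w x * (Ψ x * c) = c * ∫ x, w x * Ψ x := fun w c => by
    simp_rw [← mul_assoc, integral_mul_const, mul_comm c]
  simp only [integral_energy_separated hΨ hΨc, pull_const, mul_assoc (_ / _),
    integral_const_mul] at hweak
  have hzero : moment Ψ ut 0 = ∫ x, ε * g x * Ψ x := integral_congr_ae <| by
    filter_upwards [h.deriv_zero] with x hx
    rw [hx]
  rwa [hzero]

theorem moment_identity (h : IsWeakSolution μ p ε g T u ut Du) (hcone : SupportedInCone R T u)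
    (hΨ : IsLocalEigenfunction e ρ Ψ) {θ θ' : ℝ → ℝ} (hθ : ContDiffOn ℝ ∞ θ (Ioi (-1))) {t : ℝ}
    (hθ' : ∀ s ∈ Icc 0 t, HasDerivAt θ (θ' s) s) (ht : t ∈ Ico 0 T) (hρ : t + R < ρ) :
    θ t * moment Ψ ut t - θ 0 * moment Ψ ut 0
      + (∫ s in 0..t, (-(θ' s * moment Ψ ut s) - e * (θ s * moment Ψ u s)))
      + (∫ s in 0..t, μ / (1 + s) * (θ s * moment Ψ ut s))
      = ∫ s in 0..t, θ s * powerMoment p Ψ u s := by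
  obtain ⟨ζ, hζ, hζc, hζT, hζθ⟩ := exists_cutoff_time hθ ht.1 ht.2
  have hval : ∀ s ∈ Icc 0 t, ζ s = θ s := fun s hs => (hζθ s hs).eq_of_nhds
  have hderiv : ∀ s ∈ Icc 0 t, deriv ζ s = θ' s := fun s hs =>
    (hζθ s hs).deriv_eq.trans (hθ' s hs).deriv
  have hgrad : ∀ s ∈ Icc 0 t,
      ∫ x, inner ℝ (Du s x) (gradient Ψ x) = -(e * moment Ψ u s) := fun s hs => by
    have hsT : s ∈ Ico 0 T := ⟨hs.1, hs.2.trans_lt ht.2⟩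
    refine (h.isWeakGradient s hsT).integral_inner_gradient_eigenfunction (Lp.memLp _)
      (Lp.memLp _) hΨ ?_
    filter_upwards [hcone s hsT] with x hx hxρ
    exact hx (by linarith [hs.2])
  have hid := h.separated_identity hΨ.contDiff hΨ.hasCompactSupport hζ hζc hζT ht
  rw [hval t ⟨ht.1, le_rfl⟩, hval 0 ⟨le_rfl, ht.1⟩] at hid
  refine Eq.trans ?_ (hid.trans ?_)
  · refine congrArg₂ _ (congrArg _ ?_) ?_
    · refine intervalIntegral.integral_congr fun s hs => ?_
      rw [uIcc_of_le ht.1] at hs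
      simp only [hval s hs, hderiv s hs, hgrad s hs]
      ring
    · refine intervalIntegral.integral_congr fun s hs => ?_
      rw [uIcc_of_le ht.1] at hs
      simp only [hval s hs]
  · refine intervalIntegral.integral_congr fun s hs => ?_
    rw [uIcc_of_le ht.1] at hs
    simp only [hval s hs]

theorem flux_moment_eq (h : IsWeakSolution μ p ε g T u ut Du) (hcone : SupportedInCone R T u)
    (hΨ : IsLocalEigenfunction e ρ Ψ) {t : ℝ} (ht : t ∈ Ico 0 T) (hρ : t + R < ρ) :
    flux μ (moment Ψ u) (moment Ψ ut) t = flux μ (moment Ψ u) (moment Ψ ut) 0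
      + e * (∫ s in 0..t, (1 + s) ^ min μ 1 * moment Ψ u s)
      + ∫ s in 0..t, (1 + s) ^ min μ 1 * powerMoment p Ψ u s := by
  have hsub : Icc 0 t ⊆ Ico 0 T := fun s hs => ⟨hs.1, hs.2.trans_lt ht.2⟩
  have hshift : ContDiff ℝ ∞ fun s : ℝ => 1 + s := by fun_prop
  have hθ : ContDiffOn ℝ ∞ (fun s : ℝ => (1 + s) ^ min μ 1) (Ioi (-1)) :=
    hshift.contDiffOn.rpow_const_of_ne fun s hs => (by linarith [mem_Ioi.1 hs] : 0 < 1 + s).ne'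
  have identity := h.moment_identity hcone hΨ hθ
    (fun s hs => hasDerivAt_one_add_rpow _ (by linarith [hs.1])) ht hρ
  have damping := integral_damping (μ := μ) e ht.1
    ((h.continuousOn_moment (hΨ.memLp 2)).mono hsub)
    ((h.continuousOn_moment_deriv (hΨ.memLp 2)).mono hsub) fun s hs =>
      (h.hasDerivWithinAt_moment (hΨ.memLp 2) (hsub (Ioo_subset_Icc_self hs))).hasDerivAt
        (Ico_mem_nhds hs.1 (hs.2.trans ht.2))
  simp only [flux, add_zero, Real.one_rpow, one_mul] at identity ⊢
  linarith

end IsWeakSolution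

theorem initialFlux_le_integral_mul (hdata : IsBlowupData μ R f g)
    (hΨ : IsLocalEigenfunction e ρ Ψ) (hρ : R < ρ) :
    initialFlux μ R f g ≤ ∫ x, ((μ - 1)⁺ * f x + g x) * Ψ x := by
  have hw : MemLp (fun x => (μ - 1)⁺ * f x + g x) 2 volume :=
    (hdata.memLp_init.const_mul _).add hdata.memLp_velocity
  have hwΨ : Integrable fun x => ((μ - 1)⁺ * f x + g x) * Ψ x := hw.integrable_mul (hΨ.memLp 2)
  have : IsFiniteMeasure (volume.restrict (Metric.closedBall (0 : Space n) R)) :=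
    isFiniteMeasure_restrict.2 measure_closedBall_lt_top.ne
  calc initialFlux μ R f g
      ≤ ∫ x in Metric.closedBall 0 R, ((μ - 1)⁺ * f x + g x) * Ψ x := by
        refine setIntegral_mono_on_ae ((hw.restrict _).integrable (by norm_num))
          hwΨ.integrableOn measurableSet_closedBall ?_
        filter_upwards [hdata.flux_nonneg] with x hx hxR
        rw [mem_closedBall_zero_iff] at hxR
        exact le_mul_of_one_le_right hx (hΨ.one_le x (hxR.trans_lt hρ))
    _ ≤ ∫ x, ((μ - 1)⁺ * f x + g x) * Ψ x := setIntegral_le_integral hwΨ <| by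
        filter_upwards [hdata.flux_nonneg] with x hx using mul_nonneg hx (hΨ.nonneg x)

theorem moment_init_nonneg (hu0 : u 0 =ᵐ[volume] fun x => ε * f x)
    (hdata : IsBlowupData μ R f g) (hε : 0 ≤ ε) (hΨ : IsLocalEigenfunction e ρ Ψ) :
    0 ≤ moment Ψ u 0 := by
  rw [moment_eq_of_ae_eq hu0]
  refine mul_nonneg hε (integral_nonneg_of_ae ?_)
  filter_upwards [hdata.init_nonneg] with x hx using mul_nonneg hx (hΨ.nonneg x)

namespace IsWeakSolution

theorem mul_initialFlux_le_flux (h : IsWeakSolution μ p ε g T u ut Du)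
    (hu0 : u 0 =ᵐ[volume] fun x => ε * f x) (hdata : IsBlowupData μ R f g) (hε : 0 ≤ ε)
    (hΨ : IsLocalEigenfunction e ρ Ψ) (hρ : R < ρ) :
    ε * initialFlux μ R f g ≤ flux μ (moment Ψ u) (moment Ψ ut) 0 := by
  have hfΨ : Integrable fun x => f x * Ψ x := hdata.memLp_init.integrable_mul (hΨ.memLp 2)
  have hgΨ : Integrable fun x => g x * Ψ x := hdata.memLp_velocity.integrable_mul (hΨ.memLp 2)
  have hflux : flux μ (moment Ψ u) (moment Ψ ut) 0
      = ε * ∫ x, ((μ - 1)⁺ * f x + g x) * Ψ x := by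
    simp only [flux, moment_eq_of_ae_eq hu0, moment_eq_of_ae_eq h.deriv_zero, add_zero,
      Real.one_rpow, one_mul, add_mul, mul_assoc (μ - 1)⁺]
    rw [integral_add (hfΨ.const_mul _) hgΨ, integral_const_mul]
    ring
  rw [hflux]
  exact mul_le_mul_of_nonneg_left (initialFlux_le_integral_mul hdata hΨ hρ) hε

theorem isSupersolution_powerMoment (h : IsWeakSolution μ p ε g T u ut Du)
    (hu0 : u 0 =ᵐ[volume] fun x => ε * f x) (hcone : SupportedInCone R T u)
    (hdata : IsBlowupData μ R f g) (hε : 0 ≤ ε) (hΨ : IsLocalEigenfunction 0 ρ Ψ)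
    (hτ : τ ∈ Ico 0 T) (hρ : τ + R < ρ) :
    IsSupersolution μ (ε * initialFlux μ R f g) τ (powerMoment p Ψ u) (moment Ψ u)
      (moment Ψ ut) where
  hasDerivWithinAt t ht :=
    (h.hasDerivWithinAt_moment (hΨ.memLp 2) ⟨ht.1, ht.2.trans_lt hτ.2⟩).mono
      (Icc_subset_Ico_right hτ.2)
  continuousOn_deriv :=
    (h.continuousOn_moment_deriv (hΨ.memLp 2)).mono (Icc_subset_Ico_right hτ.2)
  init_nonneg := moment_init_nonneg hu0 hdata hε hΨ
  source_nonneg t _ _ := powerMoment_nonneg hΨ.nonneg t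
  le_flux t ht := by
    rw [h.flux_moment_eq hcone hΨ ⟨ht.1, ht.2.trans_lt hτ.2⟩ (by linarith [ht.2]), zero_mul,
      add_zero]
    gcongr
    exact h.mul_initialFlux_le_flux hu0 hdata hε hΨ (by linarith [hτ.1])

theorem isSupersolution_self (h : IsWeakSolution μ p ε g T u ut Du)
    (hu0 : u 0 =ᵐ[volume] fun x => ε * f x) (hcone : SupportedInCone R T u)
    (hdata : IsBlowupData μ R f g) (hε : 0 ≤ ε) (hΨ : IsLocalEigenfunction 1 ρ Ψ)
    (hτ : τ ∈ Ico 0 T) (hρ : τ + R < ρ) :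
    IsSupersolution μ (ε * initialFlux μ R f g) τ (moment Ψ u) (moment Ψ u)
      (moment Ψ ut) where
  hasDerivWithinAt t ht :=
    (h.hasDerivWithinAt_moment (hΨ.memLp 2) ⟨ht.1, ht.2.trans_lt hτ.2⟩).mono
      (Icc_subset_Ico_right hτ.2)
  continuousOn_deriv :=
    (h.continuousOn_moment_deriv (hΨ.memLp 2)).mono (Icc_subset_Ico_right hτ.2)
  init_nonneg := moment_init_nonneg hu0 hdata hε hΨ
  source_nonneg _ _ := id
  le_flux t ht := by
    have source_nonneg : 0 ≤ ∫ s in 0..t, (1 + s) ^ min μ 1 * powerMoment p Ψ u s :=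
      intervalIntegral.integral_nonneg ht.1 fun s hs =>
        mul_nonneg (Real.rpow_nonneg (by linarith [hs.1]) _) (powerMoment_nonneg hΨ.nonneg s)
    rw [h.flux_moment_eq hcone hΨ ⟨ht.1, ht.2.trans_lt hτ.2⟩ (by linarith [ht.2]), one_mul]
    linarith [h.mul_initialFlux_le_flux hu0 hdata hε hΨ (by linarith [hτ.1])]

end IsWeakSolution

end WeakForm

/-! ### Hölder bounds -/

section Holder

variable {n : ℕ} {μ p q ε T R ρ : ℝ} {f g w Φ : Space n → ℝ}
  {u : ℝ → Lp ℝ 2 (volume : Measure (Space n))}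

theorem abs_integral_mul_rpow_le (hpq : p.HolderConjugate q)
    (hw : MemLp w (ENNReal.ofReal p) (volume.restrict (Metric.closedBall 0 ρ)))
    (hΦ : Continuous Φ) (hΦ0 : ∀ x, 0 ≤ Φ x) :
    |∫ x in Metric.closedBall 0 ρ, w x * Φ x| ^ p
      ≤ (∫ x in Metric.closedBall 0 ρ, |w x| ^ p)
        * (∫ x in Metric.closedBall 0 ρ, Φ x ^ q) ^ (p - 1) := by
  have hΦ_memLp : MemLp Φ (ENNReal.ofReal q) (volume.restrict (Metric.closedBall 0 ρ)) := by
    obtain ⟨C, hC⟩ := (isCompact_closedBall (0 : Space n) ρ).exists_bound_of_continuousOn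
      hΦ.continuousOn
    have : IsFiniteMeasure (volume.restrict (Metric.closedBall (0 : Space n) ρ)) :=
      isFiniteMeasure_restrict.2 measure_closedBall_lt_top.ne
    refine MemLp.of_bound hΦ.aestronglyMeasurable C ?_
    filter_upwards [ae_restrict_mem measurableSet_closedBall] with x hx using hC x hx
  have abs_le : |∫ x in Metric.closedBall 0 ρ, w x * Φ x|
      ≤ ∫ x in Metric.closedBall 0 ρ, |w x| * Φ x := by
    simpa only [abs_mul, abs_of_nonneg (hΦ0 _)] using
      abs_integral_le_integral_abs (f := fun x => w x * Φ x)
        (μ := volume.restrict (Metric.closedBall 0 ρ))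
  have holder := integral_mul_le_Lp_mul_Lq_of_nonneg hpq
    (μ := volume.restrict (Metric.closedBall (0 : Space n) ρ))
    (Eventually.of_forall fun x => abs_nonneg (w x)) (Eventually.of_forall hΦ0) hw.abs hΦ_memLp
  have hA : 0 ≤ ∫ x in Metric.closedBall 0 ρ, |w x| ^ p :=
    integral_nonneg fun x => Real.rpow_nonneg (abs_nonneg _) _
  have hB : 0 ≤ ∫ x in Metric.closedBall 0 ρ, Φ x ^ q :=
    integral_nonneg fun x => Real.rpow_nonneg (hΦ0 x) _
  refine (Real.rpow_le_rpow (abs_nonneg _) (abs_le.trans holder) hpq.nonneg).trans_eq ?_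
  rw [Real.mul_rpow (by positivity) (by positivity), ← Real.rpow_mul hA, ← Real.rpow_mul hB,
    one_div_mul_cancel hpq.ne_zero, Real.rpow_one, one_div_mul_eq_div, hpq.div_conj_eq_sub_one]

theorem SupportedInCone.integral_eq (hcone : SupportedInCone R T u) {s : ℝ} (hs : s ∈ Ico 0 T)
    {F : ℝ → ℝ} (hF : F 0 = 0) {Ψ : Space n → ℝ} {r : ℝ} (hr : s + R ≤ r)
    (hΨΦ : ∀ x, ‖x‖ ≤ r → Ψ x = Φ x) :
    ∫ x, F (u s x) * Ψ x = ∫ x in Metric.closedBall 0 r, F (u s x) * Φ x := by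
  rw [← setIntegral_eq_integral_of_ae_compl_eq_zero (s := Metric.closedBall (0 : Space n) r)]
  · refine setIntegral_congr_fun measurableSet_closedBall fun x hx => ?_
    rw [mem_closedBall_zero_iff] at hx
    simp only [hΨΦ x hx]
  · filter_upwards [hcone s hs] with x hx hxr
    rw [mem_closedBall_zero_iff, not_le] at hxr
    rw [hx (by linarith), hF, zero_mul]

theorem SupportedInCone.moment_eq (hcone : SupportedInCone R T u) {s : ℝ} (hs : s ∈ Ico 0 T)
    {Ψ : Space n → ℝ} {r : ℝ} (hr : s + R ≤ r) (hΨΦ : ∀ x, ‖x‖ ≤ r → Ψ x = Φ x) :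
    moment Ψ u s = ∫ x in Metric.closedBall 0 r, u s x * Φ x :=
  hcone.integral_eq (F := id) hs rfl hr hΨΦ

theorem SupportedInCone.powerMoment_eq (hcone : SupportedInCone R T u) (hp : p ≠ 0) {s : ℝ}
    (hs : s ∈ Ico 0 T) {Ψ : Space n → ℝ} {r : ℝ} (hr : s + R ≤ r)
    (hΨ : ∀ x, ‖x‖ ≤ r → Ψ x = 1) :
    powerMoment p Ψ u s = ∫ x in Metric.closedBall 0 r, |u s x| ^ p := by
  simpa only [mul_one, powerMoment] using hcone.integral_eq (F := fun y => |y| ^ p) hs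
    (by rw [abs_zero, Real.zero_rpow hp]) hr hΨ

theorem IsEnergySolution.abs_moment_rpow_le (hu : IsEnergySolution μ p ε f g T u)
    (hcone : SupportedInCone R T u) (hpq : p.HolderConjugate q) (hΦ : Continuous Φ)
    (hΦ0 : ∀ x, 0 ≤ Φ x) {Ψ Ψ' : Space n → ℝ} {s : ℝ} (hs : s ∈ Ioo 0 T)
    (hΨ : ∀ x, ‖x‖ ≤ s + R → Ψ x = 1) (hΨ' : ∀ x, ‖x‖ ≤ s + R → Ψ' x = Φ x) :
    |moment Ψ' u s| ^ p
      ≤ powerMoment p Ψ u s * (∫ x in Metric.closedBall 0 (s + R), Φ x ^ q) ^ (p - 1) := by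
  rw [hcone.moment_eq (Ioo_subset_Ico_self hs) le_rfl hΨ',
    hcone.powerMoment_eq hpq.ne_zero (Ioo_subset_Ico_self hs) le_rfl hΨ]
  exact abs_integral_mul_rpow_le hpq
    (hu.continuousIntoLpLoc _ (isCompact_closedBall 0 (s + R)) s hs).1 hΦ hΦ0

end Holder

section BallIntegrals

theorem exists_rpow_le_mul_exp {a c : ℝ} (ha : 0 ≤ a) (hc : 0 < c) :
    ∃ C > 0, ∀ x, 0 ≤ x → (1 + x) ^ a ≤ C * Real.exp (c * x) := by
  set k := min 1 (c / (a + 1))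
  have hk0 : 0 < k := lt_min one_pos (by positivity)
  have hka : k * a ≤ c := calc
    k * a ≤ c / (a + 1) * (a + 1) := by
      gcongr
      · exact min_le_right _ _
      · linarith
    _ = c := div_mul_cancel₀ c (by positivity)
  refine ⟨k⁻¹ ^ a, by positivity, fun x hx => ?_⟩
  have linear_le : 1 + x ≤ k⁻¹ * Real.exp (k * x) := by
    rw [← div_eq_inv_mul, le_div_iff₀ hk0]
    nlinarith [Real.add_one_le_exp (k * x), min_le_left 1 (c / (a + 1))]
  calc (1 + x) ^ a ≤ (k⁻¹ * Real.exp (k * x)) ^ a := by gcongr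
    _ = k⁻¹ ^ a * Real.exp (k * a * x) := by
      rw [Real.mul_rpow (by positivity) (by positivity), ← Real.exp_mul, mul_right_comm]
    _ ≤ k⁻¹ ^ a * Real.exp (c * x) := by gcongr

theorem exists_rpow_mul_exp_le (σ : ℝ) {q : ℝ} (hq : 0 < q) :
    ∃ C > 0, ∀ y ρ, 0 ≤ y → y ≤ ρ → (1 + y) ^ σ * Real.exp (q * y)
      ≤ C * (1 + ρ) ^ σ * Real.exp (q / 2 * ρ) * Real.exp (q / 2 * y) := by
  obtain ⟨C, hC, hCx⟩ := exists_rpow_le_mul_exp (abs_nonneg σ) (half_pos hq)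
  refine ⟨C, hC, fun y ρ hy hyρ => ?_⟩
  have hρ : 0 ≤ ρ := hy.trans hyρ
  have peetre : (1 + y) ^ σ ≤ (1 + (ρ - y)) ^ |σ| * (1 + ρ) ^ σ :=
    rpow_le_rpow_abs_mul_rpow (by linarith) (by linarith) (by nlinarith) (by nlinarith) σ
  have split_exp : Real.exp (q / 2 * (ρ - y)) * Real.exp (q * y)
      = Real.exp (q / 2 * ρ) * Real.exp (q / 2 * y) := by
    rw [← Real.exp_add, ← Real.exp_add]
    ring_nf
  calc (1 + y) ^ σ * Real.exp (q * y)
      ≤ C * Real.exp (q / 2 * (ρ - y)) * (1 + ρ) ^ σ * Real.exp (q * y) := by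
        gcongr
        exact peetre.trans (by gcongr; exact hCx _ (by linarith))
    _ = C * (1 + ρ) ^ σ * (Real.exp (q / 2 * (ρ - y)) * Real.exp (q * y)) := by ring
    _ = C * (1 + ρ) ^ σ * Real.exp (q / 2 * ρ) * Real.exp (q / 2 * y) := by rw [split_exp]; ring

theorem intervalIntegrable_one_add_rpow_mul_exp (σ q : ℝ) {ρ : ℝ} (hρ : 0 ≤ ρ) :
    IntervalIntegrable (fun y => (1 + y) ^ σ * Real.exp (q * y)) volume 0 ρ :=
  ((continuousOn_one_add_rpow σ ρ).mul (by fun_prop)).intervalIntegrable_of_Icc hρ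

theorem exists_integral_rpow_mul_exp_le (σ : ℝ) {q : ℝ} (hq : 0 < q) :
    ∃ C > 0, ∀ ρ, 0 ≤ ρ →
      ∫ y in (0 : ℝ)..ρ, (1 + y) ^ σ * Real.exp (q * y) ≤ C * (1 + ρ) ^ σ * Real.exp (q * ρ) := by
  obtain ⟨C, hC, hpointwise⟩ := exists_rpow_mul_exp_le σ hq
  refine ⟨C * (2 / q), by positivity, fun ρ hρ => ?_⟩
  have integral_exp_le :
      ∫ y in (0 : ℝ)..ρ, Real.exp (q / 2 * y) ≤ 2 / q * Real.exp (q / 2 * ρ) := by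
    rw [intervalIntegral.integral_comp_mul_left (fun y => Real.exp y) (half_pos hq).ne',
      integral_exp, mul_zero, Real.exp_zero, smul_eq_mul, inv_div]
    gcongr
    linarith
  have double_exp : Real.exp (q * ρ) = Real.exp (q / 2 * ρ) * Real.exp (q / 2 * ρ) := by
    rw [← Real.exp_add]
    ring_nf
  calc ∫ y in (0 : ℝ)..ρ, (1 + y) ^ σ * Real.exp (q * y)
      ≤ ∫ y in (0 : ℝ)..ρ, C * (1 + ρ) ^ σ * Real.exp (q / 2 * ρ) * Real.exp (q / 2 * y) :=
        intervalIntegral.integral_mono_on hρ (intervalIntegrable_one_add_rpow_mul_exp σ q hρ)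
          (Continuous.intervalIntegrable (by fun_prop) _ _)
          fun y hy => hpointwise y ρ hy.1 hy.2
    _ ≤ C * (1 + ρ) ^ σ * Real.exp (q / 2 * ρ) * (2 / q * Real.exp (q / 2 * ρ)) := by
        rw [intervalIntegral.integral_const_mul]
        gcongr
    _ = C * (2 / q) * (1 + ρ) ^ σ * Real.exp (q * ρ) := by rw [double_exp]; ring

theorem setIntegral_closedBall_fun_norm (m : ℕ) (F : ℝ → ℝ) {ρ : ℝ} (hρ : 0 ≤ ρ) :
    ∫ x in Metric.closedBall (0 : Space (m + 1)) ρ, F ‖x‖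
      = (m + 1) * volume.real (Metric.ball (0 : Space (m + 1)) 1)
        * ∫ y in (0 : ℝ)..ρ, y ^ m * F y := by
  have to_indicator : ∫ x in Metric.closedBall (0 : Space (m + 1)) ρ, F ‖x‖
      = ∫ x : Space (m + 1), (Iic ρ).indicator F ‖x‖ := by
    classical
    rw [← integral_indicator measurableSet_closedBall]
    refine integral_congr_ae (Eventually.of_forall fun x => ?_)
    simp only [indicator_apply, mem_closedBall_zero_iff, mem_Iic]
  have of_indicator : ∫ y in Ioi (0 : ℝ), y ^ m • (Iic ρ).indicator F y
      = ∫ y in (0 : ℝ)..ρ, y ^ m * F y := by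
    rw [intervalIntegral.integral_of_le hρ, ← Ioi_inter_Iic,
      ← setIntegral_indicator measurableSet_Iic]
    congr 1 with y
    simp only [indicator_apply, smul_eq_mul, mul_ite, mul_zero]
  have hdim : Module.finrank ℝ (Space (m + 1)) = m + 1 := finrank_euclideanSpace_fin
  rw [to_indicator, integral_fun_norm_addHaar volume, hdim, Nat.add_sub_cancel, of_indicator,
    nsmul_eq_mul, smul_eq_mul, mul_assoc]
  push_cast
  rfl

theorem pow_mul_besselSeries_rpow_le (m : ℕ) {q y : ℝ} (hq : 0 ≤ q) (hy : 0 ≤ y) :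
    y ^ m * besselSeries (m + 1) (y ^ 2) ^ q
      ≤ ((1 + m.factorial * 2 ^ (m + 1)) / 2) ^ q
        * ((1 + y) ^ (m * (1 - q / 2)) * Real.exp (q * y)) := by
  set C : ℝ := (1 + m.factorial * 2 ^ (m + 1)) / 2
  have hB : 1 ≤ besselSeries (m + 1) (y ^ 2) := one_le_besselSeries (by positivity) (sq_nonneg y)
  calc y ^ m * besselSeries (m + 1) (y ^ 2) ^ q
      ≤ (1 + y) ^ (m : ℝ) * (C * (1 + y) ^ (-(m : ℝ) / 2) * Real.exp y) ^ q := by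
        rw [Real.rpow_natCast]
        gcongr
        · linarith
        · exact besselSeries_le_exp m hy
    _ = C ^ q * ((1 + y) ^ (m : ℝ) * (1 + y) ^ (-(m : ℝ) / 2 * q) * Real.exp (q * y)) := by
        rw [Real.mul_rpow (by positivity) (by positivity), Real.mul_rpow (by positivity)
          (by positivity), ← Real.rpow_mul (by positivity), ← Real.exp_mul, mul_comm y q]
        ring
    _ = C ^ q * ((1 + y) ^ (m * (1 - q / 2)) * Real.exp (q * y)) := by
        rw [← Real.rpow_add (by positivity)]
        ring_nf

theorem exists_integral_radialProfile_rpow_le {n : ℕ} (hn : 0 < n) {q : ℝ} (hq : 0 < q) :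
    ∃ C > 0, ∀ ρ, 0 ≤ ρ →
      ∫ x in Metric.closedBall (0 : Space n) ρ, radialProfile n 1 x ^ q
        ≤ C * (1 + ρ) ^ (((n : ℝ) - 1) * (1 - q / 2)) * Real.exp (q * ρ) := by
  obtain ⟨m, rfl⟩ := Nat.exists_eq_succ_of_ne_zero hn.ne'
  obtain ⟨C, hC, hCρ⟩ := exists_integral_rpow_mul_exp_le (m * (1 - q / 2)) hq
  set B : ℝ := (1 + m.factorial * 2 ^ (m + 1)) / 2
  set V := volume.real (Metric.ball (0 : Space (m + 1)) 1)
  have hV : 0 < V :=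
    ENNReal.toReal_pos (Metric.measure_ball_pos _ _ one_pos).ne' measure_ball_lt_top.ne
  refine ⟨(m + 1) * V * (B ^ q * C), by positivity, fun ρ hρ => ?_⟩
  have hcont : Continuous fun y : ℝ => y ^ m * besselSeries (m + 1) (y ^ 2) ^ q :=
    (continuous_pow m).mul
      (((contDiff_besselSeries (by positivity)).continuous.comp (continuous_pow 2)).rpow_const
        fun _ => Or.inr hq.le)
  have radial : ∫ y in (0 : ℝ)..ρ, y ^ m * besselSeries (m + 1) (y ^ 2) ^ q
      ≤ B ^ q * (C * (1 + ρ) ^ (m * (1 - q / 2)) * Real.exp (q * ρ)) := calc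
    _ ≤ ∫ y in (0 : ℝ)..ρ, B ^ q * ((1 + y) ^ (m * (1 - q / 2)) * Real.exp (q * y)) :=
        intervalIntegral.integral_mono_on hρ (hcont.intervalIntegrable _ _)
          ((intervalIntegrable_one_add_rpow_mul_exp _ q hρ).const_mul _)
          fun y hy => pow_mul_besselSeries_rpow_le m hq.le hy.1
    _ ≤ _ := by
        rw [intervalIntegral.integral_const_mul]
        gcongr
        exact hCρ ρ hρ
  simp only [radialProfile, one_mul, Nat.cast_succ, add_sub_cancel_right]
  rw [setIntegral_closedBall_fun_norm m (fun y => besselSeries (m + 1) (y ^ 2) ^ q) hρ]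
  calc _ ≤ (m + 1) * V * (B ^ q * (C * (1 + ρ) ^ (m * (1 - q / 2)) * Real.exp (q * ρ))) := by
        gcongr
    _ = _ := by ring

end BallIntegrals

/-! ### Lower bounds for the source -/

section SourceBounds

variable {n : ℕ} {μ p q c ε T R τ s : ℝ} {f g : Space n → ℝ}
  {u : ℝ → Lp ℝ 2 (volume : Measure (Space n))}

/-- The ordinary differential inequalities satisfied on `[0,τ]` by the mass `F = ∫ u` of a solution
with data `ε f` and `ε g`, where `N = ∫ |u|^p`. The lower bound `mass_le` comes from Hölder's
inequality on the ball of radius `s + R`, and `exp_le` from testing with an eigenfunction of the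
Laplacian. The constants `c₁`, `c₂` and `q` do not depend on `ε` and `τ`. -/
structure IsMassSystem (n : ℕ) (μ p ε c₁ c₂ q τ : ℝ) (F F₁ N : ℝ → ℝ) : Prop where
  isSupersolution : IsSupersolution μ (ε * q) τ N F F₁
  intervalIntegrable : IntervalIntegrable N volume 0 τ
  mass_le : ∀ s ∈ Icc 1 τ, c₁ * s ^ (-(n * (p - 1))) * |F s| ^ p ≤ N s
  exp_le : ∀ s ∈ Icc 1 τ, c₂ * ε ^ p * s ^ ((n : ℝ) - 1 - (n + μ - 1) * p / 2) ≤ N s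

theorem volume_real_closedBall (hn : 0 < n) {ρ : ℝ} (hρ : 0 ≤ ρ) :
    volume.real (Metric.closedBall (0 : Space n) ρ)
      = volume.real (Metric.ball (0 : Space n) 1) * ρ ^ n := by
  have : Nonempty (Fin n) := ⟨⟨0, hn⟩⟩
  rw [measureReal_def, Measure.addHaar_closedBall _ _ hρ, ENNReal.toReal_mul,
    ENNReal.toReal_ofReal (by positivity), measureReal_def, finrank_euclideanSpace_fin, mul_comm]

theorem exists_mass_le (hn : 0 < n) (hp : 1 < p) (hR : 0 ≤ R) :
    ∃ c > 0, ∀ {ε T : ℝ} {f g : Space n → ℝ} {u : ℝ → Lp ℝ 2 (volume : Measure (Space n))},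
      IsEnergySolution μ p ε f g T u → SupportedInCone R T u → ∀ {Ψ : Space n → ℝ} {s : ℝ},
      (∀ x, 0 ≤ Ψ x) → 1 ≤ s → s < T → (∀ x, ‖x‖ ≤ s + R → Ψ x = 1) →
      c * s ^ (-(n * (p - 1))) * |moment Ψ u s| ^ p ≤ powerMoment p Ψ u s := by
  set V := volume.real (Metric.ball (0 : Space n) 1)
  have hV : 0 < V :=
    ENNReal.toReal_pos (Metric.measure_ball_pos _ _ one_pos).ne' measure_ball_lt_top.ne
  refine ⟨((V * (1 + R) ^ n) ^ (p - 1))⁻¹, by positivity,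
    fun {ε T f g u} hu hcone {Ψ s} hΨ0 hs1 hsT hΨ => ?_⟩
  have hs : 0 < s := by linarith
  have holder := hu.abs_moment_rpow_le hcone (Real.HolderConjugate.conjExponent hp)
    continuous_const (fun _ => zero_le_one) ⟨hs, hsT⟩ hΨ hΨ
  simp only [Real.one_rpow] at holder
  rw [setIntegral_const, smul_eq_mul, mul_one, volume_real_closedBall hn (by linarith)] at holder
  have volume_le : (V * (s + R) ^ n) ^ (p - 1)
      ≤ (V * (1 + R) ^ n) ^ (p - 1) * s ^ (n * (p - 1)) := by
    rw [Real.rpow_mul hs.le, Real.rpow_natCast, ← Real.mul_rpow (by positivity) (by positivity),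
      mul_assoc, ← mul_pow]
    gcongr
    nlinarith
  have hN := powerMoment_nonneg (p := p) (u := u) hΨ0 s
  rw [Real.rpow_neg hs.le, ← mul_inv, ← div_eq_inv_mul, div_le_iff₀ (by positivity)]
  exact holder.trans (by gcongr)

theorem exists_integral_radialProfile_conj_rpow_le (hn : 0 < n) (hpq : p.HolderConjugate q)
    (hR : 0 ≤ R) :
    ∃ C > 0, ∀ s, 1 ≤ s →
      (∫ x in Metric.closedBall (0 : Space n) (s + R), radialProfile n 1 x ^ q) ^ (p - 1)
        ≤ C * s ^ (((n : ℝ) - 1) * (p / 2 - 1)) * Real.exp (p * s) := by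
  obtain ⟨C, hC, hCρ⟩ := exists_integral_radialProfile_rpow_le hn hpq.symm.pos
  have hp : 0 < p - 1 := hpq.sub_one_pos
  have hqp : q * (p - 1) = p := by rw [mul_comm, hpq.sub_one_mul_conj]
  set a := ((n : ℝ) - 1) * (1 - q / 2)
  set a' := ((n : ℝ) - 1) * (p / 2 - 1)
  have exponent : a * (p - 1) = a' := by
    linear_combination (-((n : ℝ) - 1) / 2) * hqp
  refine ⟨C ^ (p - 1) * (2 + R) ^ |a'| * Real.exp (p * R), by positivity, fun s hs => ?_⟩
  have weight_le : (1 + (s + R)) ^ a' ≤ (2 + R) ^ |a'| * s ^ a' :=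
    rpow_le_rpow_abs_mul_rpow (by positivity) (by positivity) (by nlinarith) (by nlinarith) a'
  have base_nonneg :
      0 ≤ ∫ x in Metric.closedBall (0 : Space n) (s + R), radialProfile n 1 x ^ q :=
    integral_nonneg fun x => Real.rpow_nonneg
      (zero_le_one.trans (one_le_radialProfile hn zero_le_one x)) _
  calc (∫ x in Metric.closedBall (0 : Space n) (s + R), radialProfile n 1 x ^ q) ^ (p - 1)
      ≤ (C * (1 + (s + R)) ^ a * Real.exp (q * (s + R))) ^ (p - 1) :=
        Real.rpow_le_rpow base_nonneg (hCρ _ (by positivity)) hp.le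
    _ = C ^ (p - 1) * (1 + (s + R)) ^ a' * (Real.exp (p * R) * Real.exp (p * s)) := by
        rw [Real.mul_rpow (by positivity) (by positivity), Real.mul_rpow (by positivity)
          (by positivity), ← Real.rpow_mul (by positivity), ← Real.exp_mul, ← Real.exp_add,
          exponent, mul_right_comm q, hqp, ← mul_add, add_comm s R]
    _ ≤ C ^ (p - 1) * ((2 + R) ^ |a'| * s ^ a') * (Real.exp (p * R) * Real.exp (p * s)) := by
        gcongr
    _ = _ := by ring

theorem IsSupersolution.rpow_mul_exp_le (h : IsSupersolution μ q τ H H H₁) (hq : 0 < q)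
    (hp : 0 ≤ p) (hs1 : 1 ≤ s) (hs : s ≤ τ) :
    q ^ p * s ^ (-(μ * p / 2)) * Real.exp (p * s) ≤ (8 * 2 ^ |μ / 2|) ^ p * |H s| ^ p := by
  have growth := (h.exp_le hq hs1 hs).trans (le_abs_self _)
  have weight_le : s ^ (-(μ / 2)) ≤ 2 ^ |μ / 2| * (1 + s) ^ (-(μ / 2)) := by
    simpa only [abs_neg] using rpow_le_rpow_abs_mul_rpow (k := 2) (by linarith) (by linarith)
      (by linarith) (by linarith) (-(μ / 2))
  calc q ^ p * s ^ (-(μ * p / 2)) * Real.exp (p * s)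
      = (q * s ^ (-(μ / 2)) * Real.exp s) ^ p := by
        rw [Real.mul_rpow (by positivity) (by positivity), Real.mul_rpow (by positivity)
          (by positivity), ← Real.rpow_mul (by positivity), ← Real.exp_mul]
        ring_nf
    _ ≤ (8 * 2 ^ |μ / 2| * (q / 8 * (1 + s) ^ (-(μ / 2)) * Real.exp s)) ^ p := by
        refine Real.rpow_le_rpow (by positivity) ?_ hp
        calc q * s ^ (-(μ / 2)) * Real.exp s
            ≤ q * (2 ^ |μ / 2| * (1 + s) ^ (-(μ / 2))) * Real.exp s := by gcongr
          _ = 8 * 2 ^ |μ / 2| * (q / 8 * (1 + s) ^ (-(μ / 2)) * Real.exp s) := by ring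
    _ ≤ (8 * 2 ^ |μ / 2| * |H s|) ^ p := by gcongr
    _ = _ := Real.mul_rpow (by positivity) (abs_nonneg _)

theorem exists_exp_le (hn : 0 < n) (hp : 1 < p) (hR : 0 ≤ R) (hc : 0 < c) :
    ∃ c₂ > 0, ∀ {ε T τ : ℝ} {f g : Space n → ℝ} {u : ℝ → Lp ℝ 2 (volume : Measure (Space n))},
      IsEnergySolution μ p ε f g T u → SupportedInCone R T u → 0 < ε → τ < T →
      ∀ {Ψ Ψ' : Space n → ℝ} {H₁ : ℝ → ℝ}, (∀ x, 0 ≤ Ψ x) →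
      (∀ x, ‖x‖ ≤ τ + R → Ψ x = 1) → (∀ x, ‖x‖ ≤ τ + R → Ψ' x = radialProfile n 1 x) →
      IsSupersolution μ (ε * c) τ (moment Ψ' u) (moment Ψ' u) H₁ → ∀ s ∈ Icc 1 τ,
      c₂ * ε ^ p * s ^ ((n : ℝ) - 1 - (n + μ - 1) * p / 2) ≤ powerMoment p Ψ u s := by
  have hpq := Real.HolderConjugate.conjExponent hp
  obtain ⟨C, hC, hCs⟩ := exists_integral_radialProfile_conj_rpow_le hn hpq hR
  set D : ℝ := (8 * 2 ^ |μ / 2|) ^ p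
  have hD : 0 < D := by positivity
  refine ⟨c ^ p / (D * C), by positivity,
    fun {ε T τ f g u} hu hcone hε hτ {Ψ Ψ' H₁} hΨ0 hΨ hΨ' h s hs => ?_⟩
  have hs0 : 0 < s := by linarith [hs.1]
  set a := ((n : ℝ) - 1) * (p / 2 - 1)
  have exponent : s ^ (-(μ * p / 2)) = s ^ ((n : ℝ) - 1 - (n + μ - 1) * p / 2) * s ^ a := by
    rw [← Real.rpow_add hs0]
    congr 1
    ring
  have holder := hu.abs_moment_rpow_le hcone hpq (contDiff_radialProfile hn 1).continuous
    (fun x => zero_le_one.trans (one_le_radialProfile hn zero_le_one x))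
    ⟨hs0, hs.2.trans_lt hτ⟩ (fun x hx => hΨ x (by linarith [hs.2]))
    (fun x hx => hΨ' x (by linarith [hs.2]))
  have hN := powerMoment_nonneg (p := p) (u := u) hΨ0 s
  have chain : (ε * c) ^ p * s ^ (-(μ * p / 2)) * Real.exp (p * s)
      ≤ D * (powerMoment p Ψ u s * (C * s ^ a * Real.exp (p * s))) := calc
    _ ≤ D * |moment Ψ' u s| ^ p :=
        h.rpow_mul_exp_le (mul_pos hε hc) (by linarith) hs.1 hs.2
    _ ≤ D * (powerMoment p Ψ u s * (C * s ^ a * Real.exp (p * s))) := by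
        gcongr
        exact holder.trans (by gcongr; exact hCs s hs.1)
  rw [exponent, Real.mul_rpow hε.le hc.le] at chain
  refine le_of_mul_le_mul_right ?_ (by positivity : 0 < D * C * (s ^ a * Real.exp (p * s)))
  calc _ = ε ^ p * c ^ p * (s ^ ((n : ℝ) - 1 - (n + μ - 1) * p / 2) * s ^ a)
        * Real.exp (p * s) := by field_simp
    _ ≤ _ := chain
    _ = _ := by ring

theorem IsEnergySolution.intervalIntegrable_powerMoment (hu : IsEnergySolution μ p ε f g T u)
    (hcone : SupportedInCone R T u) (hp : p ≠ 0) (hτ : τ ∈ Ico 0 T)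
    (hΨ : ∀ x, ‖x‖ ≤ τ + R → Ψ x = 1) : IntervalIntegrable (powerMoment p Ψ u) volume 0 τ := by
  refine (hu.integrable_nonlinearity _ (isCompact_closedBall 0 (τ + R)) τ hτ).congr fun s hs => ?_
  rw [uIoc_of_le hτ.1] at hs
  exact (hcone.powerMoment_eq hp ⟨hs.1.le, hs.2.trans_lt hτ.2⟩ (by linarith [hs.2]) hΨ).symm

theorem exists_of_lt_lifespan (h : ENNReal.ofReal τ < lifespan μ p R f g ε) :
    ∃ T u, τ < T ∧ IsEnergySolution μ p ε f g T u ∧ SupportedInCone R T u := by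
  simp only [lifespan, lt_iSup_iff] at h
  obtain ⟨T, ⟨-, u, hu, hcone⟩, hT⟩ := h
  exact ⟨T, u, lt_of_not_ge fun hTτ => hT.not_ge (ENNReal.ofReal_le_ofReal hTτ), hu, hcone⟩

theorem exists_isMassSystem (hn : 0 < n) (hp : 1 < p) (hdata : IsBlowupData μ R f g) :
    ∃ c₁ > 0, ∃ c₂ > 0, ∀ {ε τ : ℝ}, 0 < ε → 0 ≤ τ →
      ENNReal.ofReal τ < lifespan μ p R f g ε →
      ∃ F F₁ N : ℝ → ℝ, IsMassSystem n μ p ε c₁ c₂ (initialFlux μ R f g) τ F F₁ N := by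
  have hR := hdata.radius_nonneg
  obtain ⟨c₁, hc₁, mass_le⟩ := exists_mass_le (μ := μ) hn hp hR
  obtain ⟨c₂, hc₂, exp_le⟩ := exists_exp_le (μ := μ) hn hp hR hdata.initialFlux_pos
  refine ⟨c₁, hc₁, c₂, hc₂, fun {ε τ} hε hτ0 hlifespan => ?_⟩
  obtain ⟨T, u, hτT, hu, hcone⟩ := exists_of_lt_lifespan hlifespan
  have hτ : τ ∈ Ico 0 T := ⟨hτ0, hτT⟩
  have hρ : 0 < τ + R + 1 := by linarith
  obtain ⟨Ψ, hΨ, hΨ_eq⟩ := exists_cutoff_radialProfile hn le_rfl hρ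
  obtain ⟨Ψ', hΨ', hΨ'_eq⟩ := exists_cutoff_radialProfile hn zero_le_one hρ
  obtain ⟨ut, Du, h⟩ := hu.exists_isWeakSolution
  have one_on_cone (x) (hx : ‖x‖ ≤ τ + R) : Ψ x = 1 := by
    rw [hΨ_eq x (by linarith), radialProfile_zero]
  exact ⟨moment Ψ u, moment Ψ ut, powerMoment p Ψ u,
    h.isSupersolution_powerMoment hu.initial_value hcone hdata hε.le hΨ hτ (by linarith),
    hu.intervalIntegrable_powerMoment hcone (by linarith) hτ one_on_cone,
    fun s hs => mass_le hu hcone hΨ.nonneg hs.1 (hs.2.trans_lt hτ.2)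
      fun x hx => one_on_cone x (by linarith [hs.2]),
    exp_le hu hcone hε hτ.2 hΨ.nonneg one_on_cone (fun x hx => hΨ'_eq x (by linarith))
      (h.isSupersolution_self hu.initial_value hcone hdata hε.le hΨ' hτ (by linarith))⟩

end SourceBounds

/-! ### Lifespan estimates -/

section MassSystem

variable {n : ℕ} {μ p ε c₁ c₂ q σ k : ℝ} {F F₁ N : ℝ → ℝ}

theorem one_sub_min_one (μ : ℝ) : 1 - min μ 1 = (μ - 1)⁻ := by
  rw [← max_sub_sub_left, negPart_def, neg_sub, sub_self]

theorem IsMassSystem.const_mul_rpow_le (h : IsMassSystem n μ p ε c₁ c₂ q (2 * σ) F F₁ N)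
    (hε : 0 < ε) (hq : 0 < q) (hσ : 1 ≤ σ) {t : ℝ} (ht : t ∈ Icc σ (2 * σ)) :
    q / (4 * 2 ^ |(μ - 1)⁺ - min μ 1|) * (ε * σ ^ (μ - 1)⁻) ≤ F t := by
  have mass_le := h.isSupersolution.const_mul_rpow_le (mul_pos hε hq) (hσ.trans ht.1) ht.2
  rw [one_sub_min_one] at mass_le
  have := negPart_nonneg (μ - 1)
  have weight_le : σ ^ (μ - 1)⁻ ≤ (1 + t) ^ (μ - 1)⁻ := by
    gcongr
    linarith [ht.1]
  rw [div_mul_eq_mul_div, div_le_iff₀' (by positivity)]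
  calc q * (ε * σ ^ (μ - 1)⁻) = ε * q * σ ^ (μ - 1)⁻ := by ring
    _ ≤ ε * q * (1 + t) ^ (μ - 1)⁻ := by gcongr
    _ ≤ _ := mass_le

theorem IsMassSystem.const_mul_log_le (h : IsMassSystem n 1 p ε c₁ c₂ q (2 * σ) F F₁ N)
    (hε : 0 < ε) (hq : 0 < q) (hσ : 1 ≤ σ) {t : ℝ} (ht : t ∈ Icc σ (2 * σ)) :
    q * (ε * Real.log (1 + σ)) ≤ F t := by
  calc q * (ε * Real.log (1 + σ)) = ε * q * Real.log (1 + σ) := by ring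
    _ ≤ ε * q * Real.log (1 + t) := by
      gcongr
      exact ht.1
    _ ≤ F t := h.isSupersolution.const_mul_log_le (mul_pos hε hq) ⟨by linarith [ht.1], ht.2⟩

theorem IsMassSystem.exists_const_mul_rpow_mul_rpow_le (n : ℕ) (μ p : ℝ) (hc₂ : 0 < c₂) :
    ∃ k > 0, ∀ {ε q σ : ℝ} {F F₁ N : ℝ → ℝ}, IsMassSystem n μ p ε c₁ c₂ q (2 * σ) F F₁ N →
      0 < ε → 0 < q → 2 ≤ σ → ∀ t ∈ Icc σ (2 * σ),
      k * (ε ^ p * σ ^ ((n : ℝ) + 1 - (n + μ - 1) * p / 2)) ≤ F t := by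
  set β := (n : ℝ) - 1 - (n + μ - 1) * p / 2 with hβ
  set C : ℝ := 2 * (2 ^ |min μ 1| * 2 ^ |(μ - 1)⁺ - min μ 1|)
  refine ⟨c₂ / (2 ^ |β| * 4 * C), by positivity,
    fun {ε q σ F F₁ N} h hε hq hσ t ht => ?_⟩
  have hσ0 : 0 < σ := by linarith
  have source_ge : ∀ s ∈ Icc (t / 2) t, c₂ * ε ^ p * (σ ^ β / 2 ^ |β|) ≤ N s := fun s hs => by
    have hs1 : 1 ≤ s := by linarith [ht.1, hs.1]
    have weight_le : σ ^ β / 2 ^ |β| ≤ s ^ β := by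
      rw [div_le_iff₀' (by positivity)]
      exact rpow_le_rpow_abs_mul_rpow hσ0 (by linarith) (by linarith [ht.1, hs.1])
        (by linarith [ht.2, hs.2]) β
    calc _ ≤ c₂ * ε ^ p * s ^ β := by gcongr
      _ ≤ N s := h.exp_le s ⟨hs1, hs.2.trans ht.2⟩
  have mass_ge := h.isSupersolution.const_mul_sq_le_of_le_source (mul_pos hε hq)
    h.intervalIntegrable (a := t / 2) (by linarith [ht.1]) (by linarith [ht.1]) (by linarith) ht.2
    (by positivity) source_ge
  have split_weight : σ ^ ((n : ℝ) + 1 - (n + μ - 1) * p / 2) = σ ^ β * σ ^ 2 := by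
    rw [← Real.rpow_add_natCast hσ0.ne', hβ]
    congr 1
    push_cast
    ring
  rw [div_mul_eq_mul_div, div_le_iff₀ (by positivity), split_weight]
  calc c₂ * (ε ^ p * (σ ^ β * σ ^ 2))
      ≤ c₂ * (ε ^ p * (σ ^ β * t ^ 2)) := by
        gcongr
        exact ht.1
    _ = c₂ * ε ^ p * (σ ^ β / 2 ^ |β|) * (t - t / 2) ^ 2 * (2 ^ |β| * 4) := by
        field_simp
        ring
    _ ≤ C * F t * (2 ^ |β| * 4) := by gcongr
    _ = F t * (2 ^ |β| * 4 * C) := by ring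

theorem IsMassSystem.exists_rpow_gammaF_mul_lt (n : ℕ) (μ : ℝ) (hp : 1 < p) (hc₁ : 0 < c₁)
    (hk : 0 < k) :
    ∃ K, ∀ {ε c₂ q σ X : ℝ} {F F₁ N : ℝ → ℝ}, IsMassSystem n μ p ε c₁ c₂ q (2 * σ) F F₁ N →
      0 < ε → 0 < q → 1 ≤ σ → 0 < X → (∀ t ∈ Icc σ (2 * σ), k * X ≤ F t) →
      σ ^ gammaF p n * X ^ (p - 1) < K := by
  set C : ℝ := 2 * (2 ^ |min μ 1| * 2 ^ |(μ - 1)⁺ - min μ 1|)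
  have hC : 0 < C := by positivity
  set a := -(n * (p - 1)) with ha
  have ha0 : a ≤ 0 := neg_nonpos.2 (mul_nonneg n.cast_nonneg (by linarith))
  refine ⟨C * (4 * 4 ^ (1 / (p - 1))) / (c₁ * 2 ^ a * k ^ (p - 1)),
    fun {ε c₂ q σ X F F₁ N} h hε hq hσ hX hF => ?_⟩
  have hσ0 : 0 < σ := by linarith
  have source_ge : ∀ t ∈ Icc σ (2 * σ), c₁ * (2 * σ) ^ a * F t ^ p ≤ N t := fun t ht => by
    have ht0 : 0 < t := by linarith [ht.1]
    have hFt : 0 < F t := (mul_pos hk hX).trans_le (hF t ht)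
    calc c₁ * (2 * σ) ^ a * F t ^ p ≤ c₁ * t ^ a * |F t| ^ p := by
          rw [abs_of_pos hFt]
          gcongr c₁ * ?_ * _
          exact Real.rpow_le_rpow_of_nonpos ht0 ht.2 ha0
      _ ≤ N t := h.mass_le t ⟨by linarith [ht.1], ht.2⟩
  have bound := selfForcing_lt hp hσ0 hC (by positivity : 0 < c₁ * (2 * σ) ^ a) (mul_pos hk hX)
    hF source_ge fun s t ν hs hst ht hν hsource =>
      h.isSupersolution.const_mul_sq_le_of_le_source (mul_pos hε hq) h.intervalIntegrable
        (by linarith) hst (by linarith) ht hν hsource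
  rw [lt_div_iff₀ (by positivity)]
  refine bound.trans_eq' ?_
  have split_weight : σ ^ gammaF p n = σ ^ 2 * σ ^ a := by
    rw [gammaF, ha, sub_eq_add_neg 2, Real.rpow_add hσ0, Real.rpow_two]
  rw [split_weight, Real.mul_rpow zero_le_two hσ0.le, Real.mul_rpow hk.le hX.le]
  ring

end MassSystem

section Lifespan

variable {n : ℕ} {μ p ε R r γ α K : ℝ} {f g : Space n → ℝ}

theorem IsBlowupData.exists_rpow_gammaF_mul_rpow_lt (hdata : IsBlowupData μ R f g) (hn : 0 < n)
    (hp : 1 < p) :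
    ∃ K, ∀ ε σ : ℝ, 0 < ε → 2 ≤ σ → ENNReal.ofReal (2 * σ) < lifespan μ p R f g ε →
      σ ^ gammaF p (n - (μ - 1)⁻) * ε ^ (p - 1) < K := by
  obtain ⟨c₁, hc₁, c₂, -, exists_system⟩ := exists_isMassSystem hn hp hdata
  have hq := hdata.initialFlux_pos
  obtain ⟨K, hK⟩ := IsMassSystem.exists_rpow_gammaF_mul_lt n μ hp hc₁
    (by positivity : 0 < initialFlux μ R f g / (4 * 2 ^ |(μ - 1)⁺ - min μ 1|))
  refine ⟨K, fun ε σ hε hσ hlifespan => ?_⟩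
  have hσ0 : 0 < σ := by linarith
  obtain ⟨F, F₁, N, h⟩ := exists_system hε (by linarith) hlifespan
  have bound := hK h hε hq (by linarith) (by positivity)
    fun t ht => h.const_mul_rpow_le hε hq (by linarith) ht
  refine bound.trans_eq' ?_
  have exponent : gammaF p (n - (μ - 1)⁻) = gammaF p n + (μ - 1)⁻ * (p - 1) := by
    rw [gammaF, gammaF]
    ring
  rw [exponent, Real.rpow_add hσ0, Real.rpow_mul hσ0.le, Real.mul_rpow hε.le (by positivity)]
  ring

theorem IsBlowupData.exists_rpow_gammaS_mul_rpow_lt (hdata : IsBlowupData μ R f g) (hn : 0 < n)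
    (hp : 1 < p) :
    ∃ K, ∀ ε σ : ℝ, 0 < ε → 2 ≤ σ → ENNReal.ofReal (2 * σ) < lifespan μ p R f g ε →
      σ ^ (gammaS p (n + μ) / 2) * ε ^ (p * (p - 1)) < K := by
  obtain ⟨c₁, hc₁, c₂, hc₂, exists_system⟩ := exists_isMassSystem hn hp hdata
  have hq := hdata.initialFlux_pos
  obtain ⟨k, hk, mass_ge⟩ :=
    IsMassSystem.exists_const_mul_rpow_mul_rpow_le (c₁ := c₁) n μ p hc₂
  obtain ⟨K, hK⟩ := IsMassSystem.exists_rpow_gammaF_mul_lt n μ hp hc₁ hk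
  refine ⟨K, fun ε σ hε hσ hlifespan => ?_⟩
  have hσ0 : 0 < σ := by linarith
  obtain ⟨F, F₁, N, h⟩ := exists_system hε (by linarith) hlifespan
  have bound := hK h hε hq (by linarith) (by positivity) (mass_ge h hε hq hσ)
  refine bound.trans_eq' ?_
  have exponent : gammaS p (n + μ) / 2
      = gammaF p n + ((n : ℝ) + 1 - (n + μ - 1) * p / 2) * (p - 1) := by
    rw [gammaS, gammaF]
    ring
  rw [exponent, Real.rpow_add hσ0, Real.rpow_mul hσ0.le, Real.rpow_mul hε.le,
    Real.mul_rpow (by positivity) (by positivity)]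
  ring

theorem IsBlowupData.exists_mul_rpow_mul_log_lt (hdata : IsBlowupData 1 R f g) (hn : 0 < n)
    (hp : 1 < p) :
    ∃ K, ∀ ε σ : ℝ, 0 < ε → 2 ≤ σ → ENNReal.ofReal (2 * σ) < lifespan 1 p R f g ε →
      ε * σ ^ (2 / (p - 1) - n) * Real.log (1 + σ) < K := by
  obtain ⟨c₁, hc₁, c₂, -, exists_system⟩ := exists_isMassSystem hn hp hdata
  have hq := hdata.initialFlux_pos
  have hp1 : 0 < p - 1 := by linarith
  obtain ⟨K, hK⟩ := IsMassSystem.exists_rpow_gammaF_mul_lt n 1 hp hc₁ hq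
  refine ⟨K ^ (1 / (p - 1)), fun ε σ hε hσ hlifespan => ?_⟩
  have hσ0 : 0 < σ := by linarith
  have hlog : 0 < Real.log (1 + σ) := Real.log_pos (by linarith)
  obtain ⟨F, F₁, N, h⟩ := exists_system hε (by linarith) hlifespan
  have bound := hK h hε hq (by linarith) (by positivity)
    fun t ht => h.const_mul_log_le hε hq (by linarith) ht
  have exponent : gammaF p n = (2 / (p - 1) - n) * (p - 1) := by
    rw [gammaF, sub_mul, div_mul_cancel₀ _ hp1.ne']
  rw [exponent, Real.rpow_mul hσ0.le, ← Real.mul_rpow (by positivity) (by positivity)] at bound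
  rw [one_div, Real.lt_rpow_inv_iff_of_pos (by positivity)
    ((Real.rpow_nonneg (by positivity) _).trans bound.le) hp1]
  refine bound.trans_eq' ?_
  ring_nf

theorem lifespan_mono (hRr : R ≤ r) : lifespan μ p R f g ε ≤ lifespan μ p r f g ε :=
  biSup_mono fun _ ⟨hT, u, hu, hcone⟩ => ⟨hT, u, hu, fun t ht => by
    filter_upwards [hcone t ht] with x hx hxr using hx (by linarith)⟩

theorem eventually_lifespan_le_rpow (hγ : 0 < γ) (hα : 0 ≤ α)
    (h : ∀ ε σ : ℝ, 0 < ε → 2 ≤ σ → ENNReal.ofReal (2 * σ) < lifespan μ p R f g ε →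
      σ ^ γ * ε ^ α < K) :
    ∀ᶠ C in atTop, ∀ ε : ℝ, 0 < ε → ε ≤ 1 →
      lifespan μ p R f g ε ≤ ENNReal.ofReal (C * ε ^ (-(α / γ))) := by
  have large : ∀ᶠ C : ℝ in atTop, K ≤ (C / 2) ^ γ :=
    ((tendsto_rpow_atTop hγ).comp (tendsto_id.atTop_div_const two_pos)).eventually_ge_atTop K
  filter_upwards [large, eventually_ge_atTop 4] with C hK hC ε hε hε1
  have scale_ge_one : 1 ≤ ε ^ (-(α / γ)) :=
    Real.one_le_rpow_of_pos_of_le_one_of_nonpos hε hε1 (neg_nonpos.2 (by positivity))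
  by_contra! hlifespan
  rw [show C * ε ^ (-(α / γ)) = 2 * (C / 2 * ε ^ (-(α / γ))) by ring] at hlifespan
  have bound := h ε _ hε (by nlinarith) hlifespan
  rw [Real.mul_rpow (by linarith) (by positivity), ← Real.rpow_mul hε.le, mul_assoc,
    ← Real.rpow_add hε, neg_mul, div_mul_cancel₀ _ hγ.ne', neg_add_cancel, Real.rpow_zero,
    mul_one] at bound
  exact hK.not_gt bound

theorem exists_unique_log_scale (hα : 0 < α) (hε : 0 < ε) :
    ∃ φ : ℝ, ∀ s : ℝ, (0 < s ∧ ε * s ^ α * Real.log (1 + s) = 1) ↔ s = φ := by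
  have strictMono : StrictMonoOn (fun s : ℝ => ε * s ^ α * Real.log (1 + s)) (Ici 0) := by
    intro x (hx : 0 ≤ x) y _ hxy
    have hlog : 0 ≤ Real.log (1 + x) := Real.log_nonneg (by linarith)
    have hloglt : Real.log (1 + x) < Real.log (1 + y) :=
      Real.log_lt_log (by linarith) (by linarith)
    exact mul_lt_mul'' (mul_lt_mul_of_pos_left (Real.rpow_lt_rpow hx hxy hα) hε) hloglt
      (by positivity) hlog
  have continuousOn : ContinuousOn (fun s : ℝ => ε * s ^ α * Real.log (1 + s)) (Ici 0) := by
    refine (continuousOn_const.mul (continuousOn_id.rpow_const fun x _ => Or.inr hα.le)).mul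
      (ContinuousOn.log (by fun_prop) fun x (hx : 0 ≤ x) => ?_)
    linarith
  set b := Real.exp (1 / ε)
  have hb : 1 ≤ b := Real.one_le_exp (by positivity)
  have one_le_at_b : 1 ≤ ε * b ^ α * Real.log (1 + b) := by
    have hbα : 1 ≤ b ^ α := Real.one_le_rpow hb hα.le
    have hlog : 1 / ε ≤ Real.log (1 + b) := by
      rw [Real.le_log_iff_exp_le (by linarith)]
      linarith
    calc 1 = ε * 1 * (1 / ε) := by field_simp
      _ ≤ _ := by gcongr
  obtain ⟨φ, hφ, hφ1⟩ := intermediate_value_Icc (by linarith : (0 : ℝ) ≤ b)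
    (continuousOn.mono Icc_subset_Ici_self)
    (show (1 : ℝ) ∈ Icc _ _ from ⟨by simp [hα.ne'], one_le_at_b⟩)
  have hφ0 : 0 < φ := hφ.1.lt_of_ne fun h => by simp [← h] at hφ1
  exact ⟨φ, fun s => ⟨fun ⟨hs, hs1⟩ => strictMono.injOn hs.le hφ0.le (hs1.trans hφ1.symm),
    fun h => h ▸ ⟨hφ0, hφ1⟩⟩⟩

theorem one_le_of_mul_rpow_mul_log_eq_one (hα : 0 ≤ α) (hε1 : ε ≤ 1) {φ : ℝ}
    (hφ : 0 < φ) (hφ1 : ε * φ ^ α * Real.log (1 + φ) = 1) : 1 ≤ φ := by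
  by_contra! hlt
  have weight_le : ε * φ ^ α ≤ 1 :=
    mul_le_one₀ hε1 (by positivity) (Real.rpow_le_one hφ.le hlt.le hα)
  have log_lt : Real.log (1 + φ) < 1 := by
    linarith [Real.log_le_sub_one_of_pos (by linarith : 0 < 1 + φ)]
  nlinarith [Real.log_pos (by linarith : 1 < 1 + φ)]

theorem eventually_lifespan_le_log_scale (hα : 0 < α)
    (h : ∀ ε σ : ℝ, 0 < ε → 2 ≤ σ → ENNReal.ofReal (2 * σ) < lifespan μ p R f g ε →
      ε * σ ^ α * Real.log (1 + σ) < K) :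
    ∀ᶠ C in atTop, ∀ ε : ℝ, 0 < ε → ε ≤ 1 → ∃ φ₀ : ℝ,
      (∀ s : ℝ, (0 < s ∧ ε * s ^ α * Real.log (1 + s) = 1) ↔ s = φ₀) ∧
      lifespan μ p R f g ε ≤ ENNReal.ofReal (C * φ₀) := by
  have large : ∀ᶠ C : ℝ in atTop, K ≤ (C / 2) ^ α :=
    ((tendsto_rpow_atTop hα).comp (tendsto_id.atTop_div_const two_pos)).eventually_ge_atTop K
  filter_upwards [large, eventually_ge_atTop 4] with C hK hC ε hε hε1
  obtain ⟨φ, hφ⟩ := exists_unique_log_scale hα hε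
  obtain ⟨hφ0, hφ1⟩ := (hφ φ).2 rfl
  refine ⟨φ, hφ, ?_⟩
  have one_le_φ : 1 ≤ φ := one_le_of_mul_rpow_mul_log_eq_one hα.le hε1 hφ0 hφ1
  by_contra! hlifespan
  rw [show C * φ = 2 * (C / 2 * φ) by ring] at hlifespan
  have bound := h ε _ hε (by nlinarith) hlifespan
  have log_le : Real.log (1 + φ) ≤ Real.log (1 + C / 2 * φ) :=
    Real.log_le_log (by linarith) (by nlinarith)
  refine bound.not_ge ?_
  calc K ≤ (C / 2) ^ α * (ε * φ ^ α * Real.log (1 + φ)) := by rwa [hφ1, mul_one]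
    _ = ε * (C / 2 * φ) ^ α * Real.log (1 + φ) := by
      rw [Real.mul_rpow (by linarith) hφ0.le]
      ring
    _ ≤ ε * (C / 2 * φ) ^ α * Real.log (1 + C / 2 * φ) := by gcongr

end Lifespan

/-! ### Critical exponents -/

section Exponents

variable {n : ℕ} {μ ν p : ℝ}

theorem gammaF_pos_of_lt_pFujita (hp : 1 < p) (h : (p : EReal) < pFujita ν) : 0 < gammaF p ν := by
  rw [gammaF, sub_pos]
  rw [pFujita] at h
  split_ifs at h with hν
  · rw [EReal.coe_lt_coe_iff, ← sub_lt_iff_lt_add', lt_div_iff₀ hν] at h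
    rwa [mul_comm]
  · linarith [mul_nonpos_of_nonpos_of_nonneg (not_lt.1 hν) (sub_nonneg.2 hp.le)]

theorem gammaS_pos_of_lt_pStrauss (hp : 1 < p) (h : (p : EReal) < pStrauss ν) :
    0 < gammaS p ν := by
  rw [gammaS]
  rw [pStrauss] at h
  split_ifs at h with hν
  · rw [EReal.coe_lt_coe_iff, lt_div_iff₀ (by linarith)] at h
    have vertex_lt : p * (2 * (ν - 1)) - (ν + 1) < √(ν ^ 2 + 10 * ν - 7) := by linarith
    rcases le_or_gt 0 (p * (2 * (ν - 1)) - (ν + 1)) with hvertex | hvertex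
    · rw [Real.lt_sqrt hvertex] at vertex_lt
      have scaled : 0 < (ν - 1) * (2 + (ν + 1) * p - (ν - 1) * p ^ 2) := by nlinarith
      exact pos_of_mul_pos_right scaled (by linarith)
    · nlinarith
  · nlinarith [mul_nonneg (sub_nonneg.2 (not_lt.1 hν))
      (mul_nonneg (by linarith : 0 ≤ p) (sub_nonneg.2 hp.le))]

theorem gammaF_pos_or_gammaS_pos (hp : 1 < p) (h : (p : EReal) < pCrit n μ) :
    0 < gammaF p (n - (μ - 1)⁻) ∨ 0 < gammaS p (n + μ) :=
  (lt_max_iff.1 h).imp (gammaF_pos_of_lt_pFujita hp) (gammaS_pos_of_lt_pStrauss hp)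

theorem gammaF_pos_of_mul_le_two (hp : 1 < p) (hμ : μ < muStar n)
    (h : p * (n - |μ - 1|) ≤ 2) : 0 < gammaF p (n - (μ - 1)⁻) := by
  have hn : (0 : ℝ) ≤ n := n.cast_nonneg
  rw [gammaF, sub_pos]
  rcases le_total 1 μ with hμ1 | hμ1
  · rw [abs_of_nonneg (by linarith)] at h
    rw [negPart_of_nonneg (by linarith), sub_zero]
    rw [muStar, lt_div_iff₀ (by linarith)] at hμ
    have weight_pos : 0 < n + 1 - μ :=
      pos_of_mul_pos_left (by linarith) (by linarith : 0 ≤ (n : ℝ) + 2)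
    by_contra! h0
    linarith [mul_le_mul_of_nonneg_right h0 weight_pos.le,
      mul_le_mul_of_nonneg_left h hn]
  · rw [abs_of_nonpos (by linarith)] at h
    rw [negPart_of_nonpos (by linarith)]
    rcases le_or_gt ((n : ℝ) - -(μ - 1)) 0 with hd | hd
    · linarith [mul_nonpos_of_nonpos_of_nonneg hd (sub_nonneg.2 hp.le)]
    · linarith

theorem gammaS_pos_of_two_lt_mul (hp : 1 < p) (hpc : (p : EReal) < pCrit n μ)
    (h : 2 < p * (n - |μ - 1|)) : 0 < gammaS p (n + μ) := by
  refine (gammaF_pos_or_gammaS_pos hp hpc).elim (fun hF => ?_) id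
  rw [gammaF] at hF
  rw [gammaS]
  have weighted := mul_pos hF (by linarith : 0 < p)
  rcases le_total 1 μ with hμ | hμ
  · rw [abs_of_nonneg (by linarith)] at h
    rw [negPart_of_nonneg (by linarith)] at weighted
    have := mul_pos (sub_pos.2 h) (by linarith : 0 < p - 1)
    nlinarith
  · rw [negPart_of_nonpos (by linarith)] at weighted
    rw [abs_of_nonpos (by linarith)] at h
    nlinarith

theorem one_le_of_muStar_le (h : muStar n ≤ μ) : 1 ≤ μ := by
  refine le_trans ?_ h
  rw [muStar, le_div_iff₀ (by positivity)]
  nlinarith [n.cast_nonneg (α := ℝ)]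

theorem gammaF_pos_of_muStar_le (hp : 1 < p) (hpc : (p : EReal) < pCrit n μ)
    (h : muStar n ≤ μ) : 0 < gammaF p n := by
  have hμ := one_le_of_muStar_le h
  rcases gammaF_pos_or_gammaS_pos hp hpc with hF | hS
  · rwa [negPart_of_nonneg (by linarith), sub_zero] at hF
  · rw [muStar, div_le_iff₀ (by positivity)] at h
    rw [gammaS] at hS
    rw [gammaF]
    have hpp : 0 < p * (p - 1) := mul_pos (by linarith) (by linarith)
    by_contra! h0
    have threshold : (2 * (n : ℝ) ^ 2 + 2 * n) * (p * (p - 1))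
        ≤ (n + μ - 1) * (n + 2) * (p * (p - 1)) := by
      refine mul_le_mul_of_nonneg_right ?_ hpp.le
      linarith
    have subcritical : (n + μ - 1) * (p * (p - 1)) * (n + 2) < (2 + 2 * p) * (n + 2) := by
      gcongr
      linarith
    have supercritical := mul_le_mul_of_nonneg_left (by linarith : 2 ≤ n * (p - 1))
      (by positivity : 0 ≤ 2 * ((n : ℝ) + 1) * p)
    nlinarith

end Exponents

section BlowupData

variable {n : ℕ} {μ p R : ℝ} {f g : Space n → ℝ}

theorem exists_setIntegral_closedBall_pos {h : Space n → ℝ} (hh : MemLp h 2 volume)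
    (hh0 : ∀ᵐ x, 0 ≤ h x) (hne : ¬ ∀ᵐ x, h x = 0) (R : ℝ) :
    ∃ r ≥ R, 0 < ∫ x in Metric.closedBall 0 r, h x := by
  by_contra! nonpos
  have vanishes (N : ℕ) : ∀ᵐ x, x ∈ Metric.closedBall 0 (R + N) → h x = 0 := by
    have : IsFiniteMeasure (volume.restrict (Metric.closedBall (0 : Space n) (R + N))) :=
      isFiniteMeasure_restrict.2 measure_closedBall_lt_top.ne
    have nonneg := ae_restrict_of_ae (s := Metric.closedBall 0 (R + N)) hh0
    exact (ae_restrict_iff' measurableSet_closedBall).1 <|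
      (setIntegral_eq_zero_iff_of_nonneg_ae nonneg ((hh.restrict _).integrable one_le_two)).1 <|
        (nonpos (R + N) (by simp)).antisymm (integral_nonneg_of_ae nonneg)
  refine hne ?_
  filter_upwards [ae_all_iff.2 vanishes] with x hx
  obtain ⟨N, hN⟩ := exists_nat_ge (‖x‖ - R)
  exact hx N (mem_closedBall_zero_iff.2 (by linarith))

theorem exists_isBlowupData (hf : MemLp f 2 volume) (hg : MemLp g 2 volume)
    (hf_nonneg : ∀ᵐ x, 0 ≤ f x) (hh_nonneg : ∀ᵐ x, 0 ≤ (μ - 1)⁺ * f x + g x)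
    (hh_ne : ¬ ∀ᵐ x, (μ - 1)⁺ * f x + g x = 0) (R : ℝ) : ∃ r ≥ R, IsBlowupData μ r f g := by
  obtain ⟨r, hr, flux_pos⟩ := exists_setIntegral_closedBall_pos ((hf.const_mul _).add hg)
    hh_nonneg hh_ne (max R 0)
  exact ⟨r, (le_max_left _ _).trans hr, (le_max_right _ _).trans hr, hf, hg, hf_nonneg,
    hh_nonneg, flux_pos⟩

theorem IsBlowupData.eventually_lifespan_le_fujita (hdata : IsBlowupData μ R f g) (hn : 0 < n)
    (hp : 1 < p) (hγ : 0 < gammaF p (n - (μ - 1)⁻)) :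
    ∀ᶠ C in atTop, ∀ ε : ℝ, 0 < ε → ε ≤ 1 → lifespan μ p R f g ε ≤
      ENNReal.ofReal (C * ε ^ (-((p - 1) / gammaF p (n - (μ - 1)⁻)))) := by
  obtain ⟨K, hK⟩ := hdata.exists_rpow_gammaF_mul_rpow_lt hn hp
  exact eventually_lifespan_le_rpow hγ (by linarith) hK

theorem IsBlowupData.eventually_lifespan_le_strauss (hdata : IsBlowupData μ R f g) (hn : 0 < n)
    (hp : 1 < p) (hγ : 0 < gammaS p (n + μ)) :
    ∀ᶠ C in atTop, ∀ ε : ℝ, 0 < ε → ε ≤ 1 → lifespan μ p R f g ε ≤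
      ENNReal.ofReal (C * ε ^ (-(2 * p * (p - 1) / gammaS p (n + μ)))) := by
  obtain ⟨K, hK⟩ := hdata.exists_rpow_gammaS_mul_rpow_lt hn hp
  have exponent : 2 * p * (p - 1) / gammaS p (n + μ) = p * (p - 1) / (gammaS p (n + μ) / 2) := by
    field_simp
  rw [exponent]
  exact eventually_lifespan_le_rpow (half_pos hγ) (mul_nonneg (by linarith) (by linarith)) hK

theorem IsBlowupData.eventually_lifespan_le_log (hdata : IsBlowupData 1 R f g) (hn : 0 < n)
    (hp : 1 < p) (hα : 0 < 2 / (p - 1) - n) :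
    ∀ᶠ C in atTop, ∀ ε : ℝ, 0 < ε → ε ≤ 1 → ∃ φ₀ : ℝ,
      (∀ s : ℝ, (0 < s ∧ ε * s ^ (2 / (p - 1) - n) * Real.log (1 + s) = 1) ↔ s = φ₀) ∧
      lifespan 1 p R f g ε ≤ ENNReal.ofReal (C * φ₀) := by
  obtain ⟨K, hK⟩ := hdata.exists_mul_rpow_mul_log_lt hn hp
  exact eventually_lifespan_le_log_scale hα hK

theorem div_gammaF_eq_inv (hp : 1 < p) (ν : ℝ) :
    (p - 1) / gammaF p ν = (2 / (p - 1) - ν)⁻¹ := by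
  have hp1 : p - 1 ≠ 0 := by linarith
  rw [gammaF, ← inv_div, sub_div, mul_div_cancel_right₀ _ hp1]

end BlowupData

end DampedWave

open DampedWave in
theorem theorem1p1_general (n : ℕ) (hn : 1 ≤ n) (μ p R : ℝ) (hp : 1 < p)
    (hpc : (p : EReal) < pCrit n μ) (f g : Space n → ℝ) (hf : MemLp f 2 volume)
    (hg : MemLp g 2 volume) (hf_nonneg : ∀ᵐ x, 0 ≤ f x)
    (hh_nonneg : ∀ᵐ x, 0 ≤ (μ - 1)⁺ * f x + g x)
    (hh_ne : ¬ ∀ᵐ x, (μ - 1)⁺ * f x + g x = 0) :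
    ∃ C > (0 : ℝ), ∀ ε : ℝ, 0 < ε → ε ≤ 1 →
      (μ < muStar n →
        (p * (n - |μ - 1|) ≤ 2 → lifespan μ p R f g ε ≤
          ENNReal.ofReal (C * ε ^ (-((p - 1) / gammaF p (n - (μ - 1)⁻))))) ∧
        (2 < p * (n - |μ - 1|) → lifespan μ p R f g ε ≤
          ENNReal.ofReal (C * ε ^ (-(2 * p * (p - 1) / gammaS p (n + μ)))))) ∧
      (muStar n ≤ μ →
        lifespan μ p R f g ε ≤ ENNReal.ofReal (C * ε ^ (-((p - 1) / gammaF p n))) ∧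
        ε ^ (-((p - 1) / gammaF p n)) = ε ^ (-(2 / (p - 1) - n)⁻¹)) ∧
      (n = 1 → μ = 1 → p ≤ 2 → ∃ φ₀ : ℝ,
        (∀ s : ℝ, (0 < s ∧ ε * s ^ (2 / (p - 1) - 1) * Real.log (1 + s) = 1) ↔ s = φ₀) ∧
        lifespan μ p R f g ε ≤ ENNReal.ofReal (C * φ₀)) := by
  obtain ⟨r, hRr, hdata⟩ := exists_isBlowupData hf hg hf_nonneg hh_nonneg hh_ne R
  have lifespan_le (ε : ℝ) : lifespan μ p R f g ε ≤ lifespan μ p r f g ε := lifespan_mono hRr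
  have fujita_bound := eventually_imp_distrib_left.2 (hdata.eventually_lifespan_le_fujita hn hp)
  have strauss_bound := eventually_imp_distrib_left.2 (hdata.eventually_lifespan_le_strauss hn hp)
  have log_bound : ∀ᶠ C in atTop, n = 1 → μ = 1 → p ≤ 2 → ∀ ε : ℝ, 0 < ε → ε ≤ 1 → ∃ φ₀ : ℝ,
      (∀ s : ℝ, (0 < s ∧ ε * s ^ (2 / (p - 1) - 1) * Real.log (1 + s) = 1) ↔ s = φ₀) ∧
      lifespan μ p r f g ε ≤ ENNReal.ofReal (C * φ₀) := by
    simp only [eventually_imp_distrib_left]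
    rintro rfl rfl hp2
    have hα : 1 < 2 / (p - 1) := by rw [lt_div_iff₀] <;> linarith
    simpa only [Nat.cast_one] using hdata.eventually_lifespan_le_log hn hp (by simpa using hα)
  obtain ⟨C, hC, fujita, strauss, log⟩ :=
    ((eventually_gt_atTop 0).and (fujita_bound.and (strauss_bound.and log_bound))).exists
  refine ⟨C, hC, fun ε hε hε1 => ⟨fun hμ => ⟨fun h => ?_, fun h => ?_⟩, fun hμ => ⟨?_, ?_⟩,
    fun hn1 hμ1 hp2 => ?_⟩⟩
  · exact (lifespan_le ε).trans (fujita (gammaF_pos_of_mul_le_two hp hμ h) ε hε hε1)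
  · exact (lifespan_le ε).trans (strauss (gammaS_pos_of_two_lt_mul hp hpc h) ε hε hε1)
  · have hγ := gammaF_pos_of_muStar_le hp hpc hμ
    rw [negPart_of_nonneg (sub_nonneg.2 (one_le_of_muStar_le hμ)), sub_zero] at fujita
    exact (lifespan_le ε).trans (fujita hγ ε hε hε1)
  · rw [div_gammaF_eq_inv hp]
  · obtain ⟨φ₀, hφ₀, hlifespan⟩ := log hn1 hμ1 hp2 ε hε hε1
    exact ⟨φ₀, hφ₀, (lifespan_le ε).trans hlifespan⟩

theorem theorem1p1 (n : ℕ) (hn : 1 ≤ n) (μ p R : ℝ) (hμ : 0 ≤ μ) (hp : 1 < p)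
    (hpc : (p : EReal) < DampedWave.pCrit n μ) (hR : 1 ≤ R)
    (f g : DampedWave.Space n → ℝ) (hf : DampedWave.MemH1 f) (hg : MemLp g 2 volume)
    (hf_nonneg : ∀ᵐ x, 0 ≤ f x)
    (hh_nonneg : ∀ᵐ x, 0 ≤ (μ - 1)⁺ * f x + g x)
    (hh_ne : ¬ ∀ᵐ x, (μ - 1)⁺ * f x + g x = 0) :
    ∃ ε₁ > (0 : ℝ), ∃ C > (0 : ℝ), ∀ ε : ℝ, 0 < ε → ε ≤ ε₁ →
      (μ < DampedWave.muStar n →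
        (p * (n - |μ - 1|) ≤ 2 →
          DampedWave.lifespan μ p R f g ε ≤
            ENNReal.ofReal (C * ε ^ (-((p - 1) / DampedWave.gammaF p (n - (μ - 1)⁻))))) ∧
        (2 < p * (n - |μ - 1|) →
          DampedWave.lifespan μ p R f g ε ≤
            ENNReal.ofReal (C * ε ^ (-(2 * p * (p - 1) / DampedWave.gammaS p (n + μ)))))) ∧
      (DampedWave.muStar n ≤ μ →
        DampedWave.lifespan μ p R f g ε ≤
            ENNReal.ofReal (C * ε ^ (-((p - 1) / DampedWave.gammaF p n))) ∧
        ε ^ (-((p - 1) / DampedWave.gammaF p n)) = ε ^ (-(2 / (p - 1) - n)⁻¹)) ∧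
      (n = 1 → μ = 1 → p ≤ 2 →
        ∃ φ₀ : ℝ,
          (∀ s : ℝ, (0 < s ∧ ε * s ^ (2 / (p - 1) - 1) * Real.log (1 + s) = 1) ↔ s = φ₀) ∧
          DampedWave.lifespan μ p R f g ε ≤ ENNReal.ofReal (C * φ₀)) :=
  ⟨1, one_pos,
    theorem1p1_general n hn μ p R hp hpc f g hf.1 hg hf_nonneg hh_nonneg hh_ne⟩
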